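/- Let $(\overline M,J,\overline g)$ be a locally conformal Kähler (l.c.K.) manifold, i.e. an almost Hermitian manifold each point of which has an open neighbourhood $U$ with a smooth function $f_U$ on $U$ such that $(U,J,e^{-f_U}\overline g|_U)$ is Kähler (the almost complex structure $J$ is parallel for the Levi-Civita connection of $e^{-f_U}\overline g|_U$). Let $\Omega(X,Y)=\overline g(X,JY)$, let $\omega$ be the Lee form (a closed 1-form with $d\Omega=\omega\wedge\Omega$), let $B$ be the Lee vector field, $\overline g(X,B)=\omega(X)$, and let $A=-JB$ be the anti-Lee vector field. Let $M$ be a CR-submanifold of $\overline M$ (an immersed submanifold with the induced metric $g$): there is a smooth distribution $D\subset TM$ with $JD_p=D_p$ for all $p\in M$, whose orthogonal complement $D^\perp$ in $TM$ satisfies $JD_p^\perp\subset T_p^\perp M$ for all $p\in M$. Let $\mu$ be the orthogonal complement of $JD^\perp$ in the normal bundle $TM^\perp$, and let $h$ be the second fundamental form of $M$, $h(X,Y)=\overline\nabla_XY-\nabla_XY$, where $\overline\nabla$ and $\nabla$ are the Levi-Civita connections of $\overline g$ and $g$. Let $\mathfrak F^\perp$ be the totally real foliation of $M$, i.e. the foliation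 with tangent distribution $D^\perp$. The metric $g$ is called bundle-like for a foliation with tangent distribution $\mathcal D$ if the metric induced by $g$ on the transversal distribution $\mathcal D^\perp$ is parallel with respect to the intrinsic connection $\nabla'$ on $\mathcal D^\perp$: for all $X\in\Gamma(TM)$ and $Y,Z\in\Gamma(\mathcal D^\perp)$, $$X\big(g(Y,Z)\big)=g(\nabla'_XY,Z)+g(Y,\nabla'_XZ),\qquad \nabla'_XY=Q^\perp\nabla_{Q^\perp X}Y+Q^\perp[QX,Y],$$ where $Q$ and $Q^\perp$ are the orthogonal projections of $TM$ onto $\mathcal D$ and $\mathcal D^\perp$. Then the following assertions are equivalent: (i) the induced metric $g$ on $M$ is bundle-like for the totally real foliation $\mathfrak F^\perp$; (ii) for all $p\in M$ and $U,V\in D_p$, $$g(U,V)A+h(U,JV)+h(V,JU)\in T_pM\oplus\mu_p.$$ -/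

import Mathlib

open Bundle Set FiberBundle
open scoped Manifold ContDiff Topology

noncomputable section

namespace CRGeometry

/-! ### Linear algebra of a bilinear form on a single tangent space -/

section Pointwise

variable {V : Type*} [AddCommGroup V] [Module ℝ V]

open Classical in
/-- The vector `w` with `b w z = α z` for all `z`, i.e. "raising the index" of the covector `α`.
(Junk value `0` when `b` does not identify `V` with its dual; see `apply_sharp`.) -/
def sharp (b : LinearMap.BilinForm ℝ V) (α : V →ₗ[ℝ] ℝ) : V :=
  if h : Function.Bijective b then (LinearEquiv.ofBijective b h).symm α else 0

theorem bijective_of_pos [FiniteDimensional ℝ V] {b : LinearMap.BilinForm ℝ V}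
    (hb : ∀ v, v ≠ 0 → 0 < b v v) : Function.Bijective b := by
  have hinj : Function.Injective b := by
    rw [injective_iff_map_eq_zero]
    intro v hv
    by_contra h
    have := hb v h
    simp [hv] at this
  exact ⟨hinj, (LinearMap.injective_iff_surjective_of_finrank_eq_finrank
    (Subspace.dual_finrank_eq (K := ℝ) (V := V)).symm).1 hinj⟩

theorem apply_sharp [FiniteDimensional ℝ V] {b : LinearMap.BilinForm ℝ V}
    (hb : ∀ v, v ≠ 0 → 0 < b v v) (α : V →ₗ[ℝ] ℝ) (z : V) : b (sharp b α) z = α z := by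
  have h := bijective_of_pos hb
  rw [sharp, dif_pos h]
  exact congrArg (fun β : V →ₗ[ℝ] ℝ => β z) ((LinearEquiv.ofBijective b h).apply_symm_apply α)

open Classical in
/-- The `b`-orthogonal projection of `V` onto the subspace `W`.
(Junk value `0` when `V` is not the direct sum of `W` and its `b`-orthogonal complement;
see `isCompl_orthogonal_of_pos`.) -/
def orthProj (b : LinearMap.BilinForm ℝ V) (W : Submodule ℝ V) : V →ₗ[ℝ] V :=
  if h : IsCompl W (b.orthogonal W) then W.projection (b.orthogonal W) h else 0

theorem isCompl_orthogonal_of_pos [FiniteDimensional ℝ V] {b : LinearMap.BilinForm ℝ V}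
    (hs : ∀ u v, b u v = b v u) (hb : ∀ v, v ≠ 0 → 0 < b v v) (W : Submodule ℝ V) :
    IsCompl W (b.orthogonal W) := by
  have hrefl : b.IsRefl := fun u v h => by rw [hs, h]
  refine LinearMap.BilinForm.isCompl_orthogonal_of_restrict_nondegenerate hrefl ?_
  refine ⟨fun v hv => ?_, fun v hv => ?_⟩ <;>
  · by_contra h
    have h1 := hb v (fun h0 => h (Subtype.ext h0))
    have h2 := hv v
    simp at h2
    exact h1.ne' h2

end Pointwise

/-! ### Riemannian geometry on a manifold without boundary -/

section Riemannian

variable {E : Type*} [NormedAddCommGroup E] [NormedSpace ℝ E]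
  {M : Type*} [TopologicalSpace M] [ChartedSpace E M]

/-- Vector fields on `M`, without any regularity. -/
abbrev VField (E : Type*) [NormedAddCommGroup E] [NormedSpace ℝ E]
    (M : Type*) [TopologicalSpace M] [ChartedSpace E M] : Type _ :=
  ∀ p : M, TangentSpace 𝓘(ℝ, E) p

/-- Fields of bilinear forms on the tangent spaces of `M`, without any regularity. -/
abbrev BilinField (E : Type*) [NormedAddCommGroup E] [NormedSpace ℝ E]
    (M : Type*) [TopologicalSpace M] [ChartedSpace E M] : Type _ :=
  ∀ p : M, LinearMap.BilinForm ℝ (TangentSpace 𝓘(ℝ, E) p)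

/-- Distributions on `M`: a subspace of each tangent space, without any regularity. -/
abbrev SubspaceField (E : Type*) [NormedAddCommGroup E] [NormedSpace ℝ E]
    (M : Type*) [TopologicalSpace M] [ChartedSpace E M] : Type _ :=
  ∀ p : M, Submodule ℝ (TangentSpace 𝓘(ℝ, E) p)

/-- Smooth vector fields on `M`, i.e. elements of `Γ(TM)`. -/
def IsSmoothField [IsManifold 𝓘(ℝ, E) ∞ M] (X : VField E M) : Prop :=
  ContMDiff 𝓘(ℝ, E) (𝓘(ℝ, E).prod 𝓘(ℝ, E)) ∞ (T% X)

/-- A smooth distribution: a subspace of each tangent space with smooth local frames, i.e. a smooth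
vector subbundle of the tangent bundle. -/
def IsSmoothDistribution [IsManifold 𝓘(ℝ, E) ∞ M] (D : SubspaceField E M) : Prop :=
  ∀ p : M, ∃ U : Set M, IsOpen U ∧ p ∈ U ∧ ∃ (k : ℕ) (X : Fin k → VField E M),
    (∀ i, ContMDiffOn 𝓘(ℝ, E) (𝓘(ℝ, E).prod 𝓘(ℝ, E)) ∞ (T% (X i)) U) ∧
    ∀ q ∈ U, LinearIndependent ℝ (fun i => X i q) ∧
      Submodule.span ℝ (range fun i => X i q) = D q

/-- The orthogonal complement of a distribution. -/
def orthDistribution (g : BilinField E M) (D : SubspaceField E M) : SubspaceField E M :=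
  fun p => (g p).orthogonal (D p)

/-- The right-hand side of Koszul's formula for `g (∇_X Y, Z)` at the point `p`. -/
def koszul (g : BilinField E M) (X Y Z : VField E M) (p : M) : ℝ :=
  (1 / 2) *
    (mvfderiv 𝓘(ℝ, E) (fun q => g q (Y q) (Z q)) p (X p)
      + mvfderiv 𝓘(ℝ, E) (fun q => g q (X q) (Z q)) p (Y p)
      - mvfderiv 𝓘(ℝ, E) (fun q => g q (X q) (Y q)) p (Z p)
      + g p (VectorField.mlieBracket 𝓘(ℝ, E) X Y p) (Z p)
      - g p (VectorField.mlieBracket 𝓘(ℝ, E) X Z p) (Y p)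
      - g p (VectorField.mlieBracket 𝓘(ℝ, E) Y Z p) (X p))

variable [FiniteDimensional ℝ E] [IsManifold 𝓘(ℝ, E) ∞ M]

open Classical in
/-- The Levi-Civita connection `∇_X Y` of the metric `g` at the point `p`: the vector determined by
Koszul's formula `g (∇_X Y, Z) = koszul g X Y Z` for all `Z`.
(Junk value `0` when the right-hand side is not tensorial in `Z`; this does not happen for a
differentiable metric and vector fields `X`, `Y` differentiable at `p`, see
`apply_leviCivita`.) -/
def leviCivita (g : BilinField E M) (X Y : VField E M) (p : M) : TangentSpace 𝓘(ℝ, E) p :=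
  if h : TensorialAt 𝓘(ℝ, E) E (fun Z : VField E M => koszul g X Y Z p) p then
    sharp (g p) (TensorialAt.mkHom (fun Z : VField E M => koszul g X Y Z p) p h).toLinearMap
  else 0

theorem tensorialAt_koszul {g : BilinField E M} {p : M} (hs : ∀ u v, g p u v = g p v u)
    (hg : ∀ X Y : VField E M, MDiffAt (T% X) p → MDiffAt (T% Y) p →
      MDiffAt (fun q => g q (X q) (Y q)) p)
    {X Y : VField E M} (hX : MDiffAt (T% X) p) (hY : MDiffAt (T% Y) p) :
    TensorialAt 𝓘(ℝ, E) E (fun Z : VField E M => koszul g X Y Z p) p where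
  smul {f Z} hf hZ := by
    have e1 : (fun q => g q (Y q) ((f • Z) q)) = fun q => f q * g q (Y q) (Z q) := by
      ext q; simp
    have e2 : (fun q => g q (X q) ((f • Z) q)) = fun q => f q * g q (X q) (Z q) := by
      ext q; simp
    simp only [koszul, e1, e2, mvfderiv_fun_mul hf (hg Y Z hY hZ), mvfderiv_fun_mul hf (hg X Z hX hZ),
      VectorField.mlieBracket_smul_right hf hZ]
    simp [hs (Z p)]
    ring
  add {Z Z'} hZ hZ' := by
    have e1 : (fun q => g q (Y q) ((Z + Z') q)) =
        fun q => g q (Y q) (Z q) + g q (Y q) (Z' q) := by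
      ext q; simp
    have e2 : (fun q => g q (X q) ((Z + Z') q)) =
        fun q => g q (X q) (Z q) + g q (X q) (Z' q) := by
      ext q; simp
    simp only [koszul, e1, e2, mvfderiv_fun_add (hg Y Z hY hZ) (hg Y Z' hY hZ'),
      mvfderiv_fun_add (hg X Z hX hZ) (hg X Z' hX hZ'),
      VectorField.mlieBracket_add_right hZ hZ']
    simp
    ring

theorem apply_leviCivita {g : BilinField E M} {p : M} (hs : ∀ u v, g p u v = g p v u)
    (hpos : ∀ v, v ≠ 0 → 0 < g p v v)
    (hg : ∀ X Y : VField E M, MDiffAt (T% X) p → MDiffAt (T% Y) p →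
      MDiffAt (fun q => g q (X q) (Y q)) p)
    {X Y Z : VField E M} (hX : MDiffAt (T% X) p) (hY : MDiffAt (T% Y) p) (hZ : MDiffAt (T% Z) p) :
    g p (leviCivita g X Y p) (Z p) = koszul g X Y Z p := by
  have h := tensorialAt_koszul hs hg hX hY
  have : FiniteDimensional ℝ (TangentSpace 𝓘(ℝ, E) p) := inferInstanceAs (FiniteDimensional ℝ E)
  rw [leviCivita, dif_pos h, apply_sharp hpos]
  exact TensorialAt.mkHom_apply h hZ

/-- Let `F` be the tangent distribution of a foliation of `(M, g)`, with transversal distribution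
`F^⊥`, and let `Q`, `Q'` be the orthogonal projections of `TM` onto `F` and `F^⊥`.
This is the intrinsic connection `(X, Y) ↦ Q' ∇_{Q' X} Y + Q' [Q X, Y]`, for `X ∈ Γ(TM)` and
`Y ∈ Γ(F^⊥)`, on the transversal distribution. -/
def intrinsicConnection (g : BilinField E M) (F : SubspaceField E M) (X Y : VField E M) (p : M) :
    TangentSpace 𝓘(ℝ, E) p :=
  orthProj (g p) (orthDistribution g F p)
      (leviCivita g (fun q => orthProj (g q) (orthDistribution g F q) (X q)) Y p)
    + orthProj (g p) (orthDistribution g F p)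
      (VectorField.mlieBracket 𝓘(ℝ, E) (fun q => orthProj (g q) (F q) (X q)) Y p)

/-- The metric `g` is bundle-like for the foliation with tangent distribution `F`: the metric
induced by `g` on the transversal distribution `F^⊥` is parallel with respect to the intrinsic
connection on `F^⊥`. -/
def IsBundleLike (g : BilinField E M) (F : SubspaceField E M) : Prop :=
  ∀ X Y Z : VField E M, IsSmoothField X → IsSmoothField Y → IsSmoothField Z →
    (∀ p, Y p ∈ orthDistribution g F p) → (∀ p, Z p ∈ orthDistribution g F p) →
    ∀ p, mvfderiv 𝓘(ℝ, E) (fun q => g q (Y q) (Z q)) p (X p) =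
      g p (intrinsicConnection g F X Y p) (Z p) + g p (Y p) (intrinsicConnection g F X Z p)

end Riemannian

/-! ### Locally conformal Kähler manifolds -/

section LCK

variable {F : Type*} [NormedAddCommGroup F] [NormedSpace ℝ F]
  {N : Type*} [TopologicalSpace N] [ChartedSpace F N] [IsManifold 𝓘(ℝ, F) ∞ N]

/-- Smooth Riemannian metrics on `N`. -/
abbrev SmoothMetric (F : Type*) [NormedAddCommGroup F] [NormedSpace ℝ F]
    (N : Type*) [TopologicalSpace N] [ChartedSpace F N] [IsManifold 𝓘(ℝ, F) ∞ N] : Type _ :=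
  ContMDiffRiemannianMetric 𝓘(ℝ, F) ∞ F (fun x : N => TangentSpace 𝓘(ℝ, F) x)

/-- Fields of endomorphisms of the tangent spaces, without any regularity. -/
abbrev EndField (F : Type*) [NormedAddCommGroup F] [NormedSpace ℝ F]
    (N : Type*) [TopologicalSpace N] [ChartedSpace F N] : Type _ :=
  ∀ p : N, TangentSpace 𝓘(ℝ, F) p →L[ℝ] TangentSpace 𝓘(ℝ, F) p

/-- Fields of covectors, without any regularity. -/
abbrev CovectorField (F : Type*) [NormedAddCommGroup F] [NormedSpace ℝ F]
    (N : Type*) [TopologicalSpace N] [ChartedSpace F N] : Type _ :=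
  ∀ p : N, TangentSpace 𝓘(ℝ, F) p →L[ℝ] ℝ

/-- The field of bilinear forms underlying a smooth Riemannian metric. -/
def metricForm (g : SmoothMetric F N) : BilinField F N := fun p =>
  LinearMap.mk₂ ℝ (fun u v => g.inner p u v) (by simp) (by simp) (by simp) (by simp)

/-- `(N, J, g)` is an almost Hermitian manifold. -/
structure IsAlmostHermitian (g : SmoothMetric F N) (J : EndField F N) : Prop where
  smooth : ContMDiff 𝓘(ℝ, F) (𝓘(ℝ, F).prod 𝓘(ℝ, F →L[ℝ] F)) ∞
    (fun p => TotalSpace.mk' (F →L[ℝ] F)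
      (E := fun x : N => TangentSpace 𝓘(ℝ, F) x →L[ℝ] TangentSpace 𝓘(ℝ, F) x) p (J p))
  sq : ∀ p (v : TangentSpace 𝓘(ℝ, F) p), J p (J p v) = -v
  hermitian : ∀ p (u v : TangentSpace 𝓘(ℝ, F) p), g.inner p (J p u) (J p v) = g.inner p u v

/-- The almost complex structure `J` is parallel on the set `U` with respect to the Levi-Civita
connection of the metric `g`. For an open set `U` and a metric `g` on `U` that is Hermitian with
respect to `J`, this says that `(U, J, g)` is a Kähler manifold. -/
def IsKahlerOn [FiniteDimensional ℝ F] (g : BilinField F N) (J : EndField F N) (U : Set N) : Prop :=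
  ∀ p ∈ U, ∀ X Y : VField F N, MDiffAt (T% X) p → MDiffAt (T% Y) p →
    leviCivita g X (fun q => J q (Y q)) p = J p (leviCivita g X Y p)

/-- The almost Hermitian manifold `(N, J, g)` is locally conformal Kähler: every point has an open
neighbourhood `U` with a smooth function `f` on `U` such that `exp(-f) g` is Kähler on `U`. -/
def IsLCK [FiniteDimensional ℝ F] (g : SmoothMetric F N) (J : EndField F N) : Prop :=
  ∀ p : N, ∃ U : Set N, IsOpen U ∧ p ∈ U ∧ ∃ f : N → ℝ, ContMDiffOn 𝓘(ℝ, F) 𝓘(ℝ, ℝ) ∞ f U ∧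
    IsKahlerOn (fun q => Real.exp (-f q) • metricForm g q) J U

/-- The Kähler form `Ω(X, Y) = g(X, J Y)`. -/
def kahlerForm (g : SmoothMetric F N) (J : EndField F N) (X Y : VField F N) (p : N) : ℝ :=
  g.inner p (X p) (J p (Y p))

/-- The 1-form `ω = lee` is the Lee form of `(N, J, g)`: a smooth closed 1-form with
`dΩ = ω ∧ Ω`. The exterior derivatives `dω(X, Y)` and `dΩ(X, Y, Z)` are written out by means of
Lie brackets. -/
structure IsLeeForm (g : SmoothMetric F N) (J : EndField F N) (lee : CovectorField F N) : Prop where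
  smooth : ContMDiff 𝓘(ℝ, F) (𝓘(ℝ, F).prod 𝓘(ℝ, F →L[ℝ] ℝ)) ∞
    (fun p => TotalSpace.mk' (F →L[ℝ] ℝ)
      (E := fun x : N => TangentSpace 𝓘(ℝ, F) x →L[ℝ] ℝ) p (lee p))
  closed : ∀ (p : N) (X Y : VField F N), MDiffAt (T% X) p → MDiffAt (T% Y) p →
    mvfderiv 𝓘(ℝ, F) (fun q => lee q (Y q)) p (X p)
      - mvfderiv 𝓘(ℝ, F) (fun q => lee q (X q)) p (Y p)
      - lee p (VectorField.mlieBracket 𝓘(ℝ, F) X Y p) = 0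
  d_kahlerForm : ∀ (p : N) (X Y Z : VField F N),
    MDiffAt (T% X) p → MDiffAt (T% Y) p → MDiffAt (T% Z) p →
    mvfderiv 𝓘(ℝ, F) (kahlerForm g J Y Z) p (X p)
      - mvfderiv 𝓘(ℝ, F) (kahlerForm g J X Z) p (Y p)
      + mvfderiv 𝓘(ℝ, F) (kahlerForm g J X Y) p (Z p)
      - kahlerForm g J (VectorField.mlieBracket 𝓘(ℝ, F) X Y) Z p
      + kahlerForm g J (VectorField.mlieBracket 𝓘(ℝ, F) X Z) Y p
      - kahlerForm g J (VectorField.mlieBracket 𝓘(ℝ, F) Y Z) X p =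
    lee p (X p) * kahlerForm g J Y Z p + lee p (Y p) * kahlerForm g J Z X p
      + lee p (Z p) * kahlerForm g J X Y p

/-- The Lee vector field `B = ω^♯`. -/
def leeField (g : SmoothMetric F N) (lee : CovectorField F N) : VField F N :=
  fun p => sharp (metricForm g p) (lee p).toLinearMap

/-- The anti-Lee vector field `A = -J B`. -/
def antiLeeField (g : SmoothMetric F N) (J : EndField F N) (lee : CovectorField F N) : VField F N :=
  fun p => -J p (leeField g lee p)

end LCK

/-! ### CR-submanifolds -/

section Submanifold

variable {F : Type*} [NormedAddCommGroup F] [NormedSpace ℝ F]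
  {N : Type*} [TopologicalSpace N] [ChartedSpace F N] [IsManifold 𝓘(ℝ, F) ∞ N]
  {E : Type*} [NormedAddCommGroup E] [NormedSpace ℝ E]
  {M : Type*} [TopologicalSpace M] [ChartedSpace E M]

/-- The metric induced on `M` by a map `ι : M → N`. -/
def inducedMetric (g : SmoothMetric F N) (ι : M → N) : BilinField E M := fun p =>
  (metricForm g (ι p)).comp (mfderiv 𝓘(ℝ, E) 𝓘(ℝ, F) ι p).toLinearMap
    (mfderiv 𝓘(ℝ, E) 𝓘(ℝ, F) ι p).toLinearMap

/-- The tangent space of the immersed submanifold `ι : M → N` at `p`, as a subspace of the ambient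
tangent space. -/
def tangentImage (E : Type*) [NormedAddCommGroup E] [NormedSpace ℝ E]
    {M : Type*} [TopologicalSpace M] [ChartedSpace E M] (ι : M → N) (p : M) :
    Submodule ℝ (TangentSpace 𝓘(ℝ, F) (ι p)) :=
  LinearMap.range (mfderiv 𝓘(ℝ, E) 𝓘(ℝ, F) ι p).toLinearMap

/-- The subspace `J (dι (D_p))` of the ambient tangent space. -/
def mapJ (J : EndField F N) (ι : M → N) (D : SubspaceField E M) (p : M) :
    Submodule ℝ (TangentSpace 𝓘(ℝ, F) (ι p)) :=
  ((D p).map (mfderiv 𝓘(ℝ, E) 𝓘(ℝ, F) ι p).toLinearMap).map (J (ι p)).toLinearMap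

/-- `D` makes the immersed submanifold `ι : M → N` a CR-submanifold of `(N, J, g)`: it is a smooth
distribution which is holomorphic (`J D = D`) and whose orthogonal complement in `TM` is totally
real (`J D^⊥ ⊆ TM^⊥`). -/
structure IsCRSubmanifold [IsManifold 𝓘(ℝ, E) ∞ M] (g : SmoothMetric F N) (J : EndField F N) (ι : M → N)
    (D : SubspaceField E M) : Prop where
  smooth : IsSmoothDistribution D
  holomorphic : ∀ p, mapJ J ι D p = (D p).map (mfderiv 𝓘(ℝ, E) 𝓘(ℝ, F) ι p).toLinearMap
  totallyReal : ∀ p, mapJ J ι (orthDistribution (inducedMetric g ι) D) p ≤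
    (metricForm g (ι p)).orthogonal (tangentImage E ι p)

/-- The subbundle `μ` of the normal bundle: the orthogonal complement of `J D^⊥` in `TM^⊥`. -/
def muBundle (g : SmoothMetric F N) (J : EndField F N) (ι : M → N) (D : SubspaceField E M) (p : M) :
    Submodule ℝ (TangentSpace 𝓘(ℝ, F) (ι p)) :=
  (metricForm g (ι p)).orthogonal (tangentImage E ι p) ⊓
    (metricForm g (ι p)).orthogonal (mapJ J ι (orthDistribution (inducedMetric g ι) D) p)

variable [FiniteDimensional ℝ F]

/-- The covariant derivative at `p`, in the direction `u ∈ T_p M`, of a vector field `W` of `N`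
along the map `ι : M → N`, with respect to the Levi-Civita connection of `g`.
If `e_1, …, e_m` is the frame of `TN` over the trivialization at `ι p` and
`W = ∑ w^i (e_i ∘ ι)` near `p`, this is `∑ (u w^i) e_i + ∑ w^i(p) ∇_{dι u} e_i`, the second sum being
the derivative of the local vector field `∑ w^i(p) e_i` of `N` extending `W p`. -/
def covDerivAlong (g : SmoothMetric F N) (ι : M → N) (W : ∀ p : M, TangentSpace 𝓘(ℝ, F) (ι p)) (p : M)
    (u : TangentSpace 𝓘(ℝ, E) p) : TangentSpace 𝓘(ℝ, F) (ι p) :=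
  (trivializationAt F (TangentSpace 𝓘(ℝ, F) : N → Type _) (ι p)).symmL ℝ (ι p)
      (mvfderiv 𝓘(ℝ, E) (fun q =>
        (trivializationAt F (TangentSpace 𝓘(ℝ, F) : N → Type _) (ι p)).continuousLinearMapAt ℝ
          (ι q) (W q)) p u)
    + leviCivita (metricForm g)
        (extend F (E := (TangentSpace 𝓘(ℝ, F) : N → Type _)) (mfderiv 𝓘(ℝ, E) 𝓘(ℝ, F) ι p u))
        (extend F (E := (TangentSpace 𝓘(ℝ, F) : N → Type _)) (W p)) (ι p)

variable [FiniteDimensional ℝ E] [IsManifold 𝓘(ℝ, E) ∞ M]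

/-- The second fundamental form of the isometric immersion `ι : M → N`, given by the Gauss formula
`h(u, v) = ∇̄_u (dι V) - dι (∇_u V)`, where `∇̄` and `∇` are the Levi-Civita connections of `N` and
of `M` with the induced metric, and `V` is a local vector field on `M` extending `v`. -/
def secondFundamentalForm (g : SmoothMetric F N) (ι : M → N) (p : M) (u v : TangentSpace 𝓘(ℝ, E) p) :
    TangentSpace 𝓘(ℝ, F) (ι p) :=
  covDerivAlong g ι (fun q => mfderiv 𝓘(ℝ, E) 𝓘(ℝ, F) ι q
      (extend E (E := (TangentSpace 𝓘(ℝ, E) : M → Type _)) v q)) p u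
    - mfderiv 𝓘(ℝ, E) 𝓘(ℝ, F) ι p
      (leviCivita (inducedMetric g ι)
        (extend E (E := (TangentSpace 𝓘(ℝ, E) : M → Type _)) u)
        (extend E (E := (TangentSpace 𝓘(ℝ, E) : M → Type _)) v) p)

end Submanifold

end CRGeometry

end

open CRGeometry

/-!
Write `K(X, Y, Z) = g(∇_X Y, Z)` for the Koszul expression of a metric. Everything is reduced to
identities between such expressions.

The transversal distribution of the foliation `D^⊥` is `D`. For `X ∈ Γ(TM)` with component `ξ` in
`D^⊥`, and `Y, Z ∈ Γ(D)`, compatibility of `∇` with the metric and vanishing of its torsion show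
that the two sides of the equation defining a bundle-like metric differ by `K(Y, ξ, Z) + K(Z, ξ, Y)`
(`apply_intrinsicConnection_add`). This is tensorial, so that bundle-likeness is a condition on
`ξ ∈ D^⊥` and `Y, Z ∈ D` at each point.

On the other side, `T_p M ⊕ μ_p` is the orthogonal complement of `J D^⊥`, so the second condition
says that `g(Y, Z) A + h(Y, J Z) + h(Z, J Y)` is orthogonal to `J ξ` for all `ξ ∈ D^⊥`. That inner
product is `-(K(Y, ξ, Z) + K(Z, ξ, Y))`, which is
`apply_smul_antiLeeField_add_secondFundamentalForm`. Indeed `J ξ` is normal, so by the Weingarten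
equation (`apply_secondFundamentalForm`) the inner product of `h(Y, J Z)` with `J ξ` is minus the
ambient `K(Y, J ξ, J Z)`. If `J` were parallel, this would be `-K(Y, ξ, Z)`. In general the ambient
metric becomes Kähler after multiplication by `exp (-f)`, and `J` fails to be parallel by terms
in `df` (`koszul_apply_left_add_koszul_apply_right`). After symmetrization in `Y` and `Z`, what
remains of them is `df(ξ) g(Y, Z)`. The anti-Lee field contributes `-ω(ξ) g(Y, Z)`, and
`ω(ξ) = df(ξ)` as soon as `D ≠ 0`, because `dΩ` is both `ω ∧ Ω` and `df ∧ Ω`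
(`IsLeeForm.apply_mul_eq`).

The Levi-Civita connections of `N` and `M` are compared by means of `ι`-related vector fields. They
exist because an immersion has local left inverses (`exists_isRelatedAt`), and their Lie brackets
are related (`mfderiv_mlieBracket`), so the Koszul expressions agree (`koszul_inducedMetric`). The
projections to `D` and `D^⊥` preserve differentiability by inversion of a Gram matrix
(`mdifferentiableAt_orthProj`).
-/

noncomputable section

namespace CRGeometry

/-! ### Calculus with the Koszul expression -/

section VectorValued

variable {E : Type*} [NormedAddCommGroup E] [NormedSpace ℝ E]
  {M : Type*} [TopologicalSpace M] [ChartedSpace E M]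
  {E' : Type*} [NormedAddCommGroup E'] [NormedSpace ℝ E']
  {M' : Type*} [TopologicalSpace M'] [ChartedSpace E' M']
  {G : Type*} [NormedAddCommGroup G] [NormedSpace ℝ G]

theorem mvfderiv_congr_of_eventuallyEq {f h : M → G} {p : M} (H : f =ᶠ[𝓝 p] h) :
    mvfderiv 𝓘(ℝ, E) f p = mvfderiv 𝓘(ℝ, E) h p := by
  ext v
  exact congrArg (fun L : E →L[ℝ] G => L v) H.mfderiv_eq

theorem mvfderiv_comp_apply_vector {h : M' → G} {f : M → M'} (p : M)
    (hh : MDifferentiableAt 𝓘(ℝ, E') 𝓘(ℝ, G) h (f p))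
    (hf : MDifferentiableAt 𝓘(ℝ, E) 𝓘(ℝ, E') f p) (v : TangentSpace 𝓘(ℝ, E) p) :
    mvfderiv 𝓘(ℝ, E) (h ∘ f) p v =
      mvfderiv 𝓘(ℝ, E') h (f p) (mfderiv 𝓘(ℝ, E) 𝓘(ℝ, E') f p v) :=
  mfderiv_comp_apply p hh hf v

end VectorValued

section Koszul

variable {E : Type*} [NormedAddCommGroup E] [NormedSpace ℝ E]
  {M : Type*} [TopologicalSpace M] [ChartedSpace E M]

/-- The properties of a field `g` of bilinear forms that are used at the point `p`: it is symmetric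
everywhere, positive definite at `p`, and differentiable at `p`, the latter being expressed by
means of the functions `g (X, Y)`. -/
structure IsMetricAt [IsManifold 𝓘(ℝ, E) ∞ M] (g : BilinField E M) (p : M) : Prop where
  symm : ∀ q u v, g q u v = g q v u
  pos : ∀ v, v ≠ 0 → 0 < g p v v
  mdiff : ∀ X Y : VField E M, MDiffAt (T% X) p → MDiffAt (T% Y) p →
    MDiffAt (fun q => g q (X q) (Y q)) p

variable {g : BilinField E M} {p : M}

/-- Compatibility of the Levi-Civita connection with the metric. -/
theorem koszul_add_koszul_swap (hg : ∀ q u v, g q u v = g q v u) (X Y Z : VField E M) :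
    koszul g X Y Z p + koszul g X Z Y p =
      mvfderiv 𝓘(ℝ, E) (fun q => g q (Y q) (Z q)) p (X p) := by
  have e1 : (fun q => g q (Z q) (Y q)) = fun q => g q (Y q) (Z q) := funext fun q => hg q _ _
  simp only [koszul, e1, VectorField.mlieBracket_swap_apply (V := Z) (W := Y), map_neg,
    LinearMap.neg_apply]
  ring

/-- The Levi-Civita connection is torsion-free. -/
theorem koszul_sub_koszul_swap (hg : ∀ q u v, g q u v = g q v u) (X Y Z : VField E M) :
    koszul g X Y Z p - koszul g Y X Z p = g p (VectorField.mlieBracket 𝓘(ℝ, E) X Y p) (Z p) := by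
  have e1 : (fun q => g q (Y q) (X q)) = fun q => g q (X q) (Y q) := funext fun q => hg q _ _
  simp only [koszul, e1, VectorField.mlieBracket_swap_apply (V := Y) (W := X), map_neg,
    LinearMap.neg_apply]
  ring

variable [IsManifold 𝓘(ℝ, E) ∞ M]

theorem IsMetricAt.eq_of_forall (hg : IsMetricAt g p) {v w : TangentSpace 𝓘(ℝ, E) p}
    (h : ∀ z, g p v z = g p w z) : v = w := by
  by_contra hne
  have h1 := hg.pos (v - w) (sub_ne_zero.2 hne)
  have h2 := h (v - w)
  rw [LinearMap.BilinForm.sub_left, h2, sub_self] at h1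
  exact h1.false

theorem IsMetricAt.exp_smul (hg : IsMetricAt g p) {f : M → ℝ} (hf : MDiffAt f p) :
    IsMetricAt (fun q => Real.exp (-f q) • g q) p where
  symm q u v := by simp [hg.symm q u v]
  pos v hv := by simpa using mul_pos (Real.exp_pos (-f p)) (hg.pos v hv)
  mdiff X Y hX hY := by
    have he : MDiffAt (fun q => Real.exp (-f q)) p :=
      (Real.differentiableAt_exp.comp_mdifferentiableAt hf.neg :)
    simpa using! he.mul (hg.mdiff X Y hX hY)

/-- The components of the vector field `Y` in the trivialization of the tangent bundle at `p`, with
values in the model space. They are `0` outside of the domain of this trivialization. -/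
def components (p : M) (Y : VField E M) (q : M) : E :=
  (trivializationAt E (TangentSpace 𝓘(ℝ, E) : M → Type _) p).continuousLinearMapAt ℝ q (Y q)

theorem mdifferentiableAt_components {Y : VField E M} (hY : MDiffAt (T% Y) p) :
    MDiffAt (components p Y) p := by
  refine ((mdifferentiableAt_section _ _).1 hY).congr_of_eventuallyEq ?_
  filter_upwards [(trivializationAt E (TangentSpace 𝓘(ℝ, E) : M → Type _) p).open_baseSet.mem_nhds
    (mem_baseSet_trivializationAt E _ p)] with q hq
  rw [components, Trivialization.continuousLinearMapAt_apply,
    Trivialization.coe_linearMapAt_of_mem _ hq]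

theorem symmL_components (p : M) (Y : VField E M) :
    (trivializationAt E (TangentSpace 𝓘(ℝ, E) : M → Type _) p).symmL ℝ p (components p Y p) =
      Y p :=
  Trivialization.symmL_continuousLinearMapAt _ (mem_baseSet_trivializationAt E _ p) _

theorem components_extend_eventuallyEq (v : TangentSpace 𝓘(ℝ, E) p) :
    components p (extend E (E := (TangentSpace 𝓘(ℝ, E) : M → Type _)) v) =ᶠ[𝓝 p]
      fun _ => (trivializationAt E (TangentSpace 𝓘(ℝ, E) : M → Type _) p ⟨p, v⟩).2 := by
  filter_upwards [(trivializationAt E (TangentSpace 𝓘(ℝ, E) : M → Type _) p).open_baseSet.mem_nhds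
    (mem_baseSet_trivializationAt E _ p)] with q hq
  rw [components, extend, ← Trivialization.symmL_apply (R := ℝ),
    Trivialization.continuousLinearMapAt_symmL _ hq]
  exact hq

/-- The Koszul expression of the conformally changed metric `exp (-f) g`. -/
theorem koszul_exp_smul (hg : IsMetricAt g p) {f : M → ℝ} (hf : MDiffAt f p) {X Y Z : VField E M}
    (hX : MDiffAt (T% X) p) (hY : MDiffAt (T% Y) p) (hZ : MDiffAt (T% Z) p) :
    koszul (fun q => Real.exp (-f q) • g q) X Y Z p =
      Real.exp (-f p) * (koszul g X Y Z p - (1 / 2) *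
        (mvfderiv 𝓘(ℝ, E) f p (X p) * g p (Y p) (Z p)
          + mvfderiv 𝓘(ℝ, E) f p (Y p) * g p (X p) (Z p)
          - mvfderiv 𝓘(ℝ, E) f p (Z p) * g p (X p) (Y p))) := by
  have he : MDiffAt (fun q => Real.exp (-f q)) p :=
    (Real.differentiableAt_exp.comp_mdifferentiableAt hf.neg :)
  have hd : ∀ w, mvfderiv 𝓘(ℝ, E) (fun q => Real.exp (-f q)) p w =
      - (Real.exp (-f p) * mvfderiv 𝓘(ℝ, E) f p w) := by
    intro w
    have h1 := mvfderiv_comp_apply (I := 𝓘(ℝ, ℝ)) (I' := 𝓘(ℝ, E)) (f := fun q => -f q)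
      (g := Real.exp) p Real.differentiableAt_exp.mdifferentiableAt hf.neg w
    have h2 : mfderiv 𝓘(ℝ, E) 𝓘(ℝ, ℝ) (fun q => -f q) p w = -mvfderiv 𝓘(ℝ, E) f p w :=
      congrArg (fun L => L w) (mvfderiv_fun_neg (I := 𝓘(ℝ, E)) (g := f) (x := p))
    have h3 : ∀ t s : ℝ, mvfderiv 𝓘(ℝ, ℝ) Real.exp t s = s * Real.exp t := fun t s => by
      have h4 : mvfderiv 𝓘(ℝ, ℝ) Real.exp t s = fderiv ℝ Real.exp t s := by
        rw [mvfderiv, mfderiv_eq_fderiv]; rfl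
      simp [h4]
    refine h1.trans ?_
    rw [h2, h3]
    ring
  simp only [koszul, LinearMap.smul_apply, smul_eq_mul, mvfderiv_fun_mul he (hg.mdiff X Y hX hY),
    mvfderiv_fun_mul he (hg.mdiff X Z hX hZ), mvfderiv_fun_mul he (hg.mdiff Y Z hY hZ)]
  simp [hd]
  ring

variable [FiniteDimensional ℝ E]

/-- The value of `∇_X Y` at `p` depends on the field `X` only through its value at `p`. -/
theorem tensorialAt_koszul_left (hg : IsMetricAt g p) {Y Z : VField E M}
    (hY : MDiffAt (T% Y) p) (hZ : MDiffAt (T% Z) p) :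
    TensorialAt 𝓘(ℝ, E) E (fun X : VField E M => koszul g X Y Z p) p where
  smul {f X} hf hX := by
    have e1 : (fun q => g q ((f • X) q) (Z q)) = fun q => f q * g q (X q) (Z q) := by
      ext q; simp
    have e2 : (fun q => g q ((f • X) q) (Y q)) = fun q => f q * g q (X q) (Y q) := by
      ext q; simp
    simp only [koszul, e1, e2, mvfderiv_fun_mul hf (hg.mdiff X Y hX hY),
      mvfderiv_fun_mul hf (hg.mdiff X Z hX hZ), VectorField.mlieBracket_smul_left hf hX]
    simp [hg.symm p (X p)]
    ring
  add {X X'} hX hX' := by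
    have e1 : (fun q => g q ((X + X') q) (Z q)) =
        fun q => g q (X q) (Z q) + g q (X' q) (Z q) := by
      ext q; simp
    have e2 : (fun q => g q ((X + X') q) (Y q)) =
        fun q => g q (X q) (Y q) + g q (X' q) (Y q) := by
      ext q; simp
    simp only [koszul, e1, e2, mvfderiv_fun_add (hg.mdiff X Y hX hY) (hg.mdiff X' Y hX' hY),
      mvfderiv_fun_add (hg.mdiff X Z hX hZ) (hg.mdiff X' Z hX' hZ),
      VectorField.mlieBracket_add_left hX hX']
    simp
    ring

theorem koszul_congr_left (hg : IsMetricAt g p) {X X' Y Z : VField E M}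
    (hX : MDiffAt (T% X) p) (hX' : MDiffAt (T% X') p)
    (hY : MDiffAt (T% Y) p) (hZ : MDiffAt (T% Z) p) (h : X p = X' p) :
    koszul g X Y Z p = koszul g X' Y Z p :=
  (tensorialAt_koszul_left hg hY hZ).pointwise hX hX' h

theorem koszul_congr_right (hg : IsMetricAt g p) {X Y Z Z' : VField E M}
    (hX : MDiffAt (T% X) p) (hY : MDiffAt (T% Y) p)
    (hZ : MDiffAt (T% Z) p) (hZ' : MDiffAt (T% Z') p) (h : Z p = Z' p) :
    koszul g X Y Z p = koszul g X Y Z' p :=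
  (tensorialAt_koszul (hg.symm p) hg.mdiff hX hY).pointwise hZ hZ' h

theorem IsMetricAt.apply_leviCivita (hg : IsMetricAt g p) {X Y Z : VField E M}
    (hX : MDiffAt (T% X) p) (hY : MDiffAt (T% Y) p) (hZ : MDiffAt (T% Z) p) :
    g p (leviCivita g X Y p) (Z p) = koszul g X Y Z p :=
  CRGeometry.apply_leviCivita (hg.symm p) hg.pos hg.mdiff hX hY hZ

/-- The derivative of the components of a vector field obeys the same Leibniz rule as the
Koszul expression, so that their difference is tensorial in the differentiated field. -/
theorem tensorialAt_koszul_sub_mvfderiv (hg : IsMetricAt g p) {X Z : VField E M}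
    (hX : MDiffAt (T% X) p) (hZ : MDiffAt (T% Z) p) :
    TensorialAt 𝓘(ℝ, E) E (fun Y : VField E M => koszul g X Y Z p -
      g p ((trivializationAt E (TangentSpace 𝓘(ℝ, E) : M → Type _) p).symmL ℝ p
        (mvfderiv 𝓘(ℝ, E) (components p Y) p (X p))) (Z p)) p where
  smul {f Y} hf hY := by
    have e1 : (fun q => g q ((f • Y) q) (Z q)) = fun q => f q * g q (Y q) (Z q) := by
      ext q; simp
    have e2 : (fun q => g q (X q) ((f • Y) q)) = fun q => f q * g q (X q) (Y q) := by
      ext q; simp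
    have e3 : components p (f • Y) = f • components p Y := by
      ext q; simp [components]
    simp only [koszul, e1, e2, e3, mvfderiv_fun_mul hf (hg.mdiff X Y hX hY),
      mvfderiv_smul hf (mdifferentiableAt_components hY),
      mvfderiv_fun_mul hf (hg.mdiff Y Z hY hZ), VectorField.mlieBracket_smul_right hf hY,
      VectorField.mlieBracket_smul_left hf hY, add_apply, map_add, map_smul, smul_apply,
      ContinuousLinearMap.smulRight_apply, symmL_components]
    simp [hg.symm p (X p)]
    ring
  add {Y Y'} hY hY' := by
    have e1 : (fun q => g q ((Y + Y') q) (Z q)) =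
        fun q => g q (Y q) (Z q) + g q (Y' q) (Z q) := by
      ext q; simp
    have e2 : (fun q => g q (X q) ((Y + Y') q)) =
        fun q => g q (X q) (Y q) + g q (X q) (Y' q) := by
      ext q; simp
    have e3 : components p (Y + Y') = components p Y + components p Y' := by
      ext q; simp [components]
    simp only [koszul, e1, e2, e3, mvfderiv_fun_add (hg.mdiff Y Z hY hZ) (hg.mdiff Y' Z hY' hZ),
      mvfderiv_add (mdifferentiableAt_components hY) (mdifferentiableAt_components hY'),
      mvfderiv_fun_add (hg.mdiff X Y hX hY) (hg.mdiff X Y' hX hY'),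
      VectorField.mlieBracket_add_left hY hY', VectorField.mlieBracket_add_right hY hY']
    simp
    ring

/-- The Levi-Civita connection, split into the derivative of the components in the trivialization
of the tangent bundle at `p` and the covariant derivative of a frame field. -/
theorem leviCivita_eq_mvfderiv_components_add (hg : IsMetricAt g p) {X Y : VField E M}
    (hX : MDiffAt (T% X) p) (hY : MDiffAt (T% Y) p) :
    leviCivita g X Y p =
      (trivializationAt E (TangentSpace 𝓘(ℝ, E) : M → Type _) p).symmL ℝ p
        (mvfderiv 𝓘(ℝ, E) (components p Y) p (X p))
      + leviCivita g (extend E (E := (TangentSpace 𝓘(ℝ, E) : M → Type _)) (X p))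
        (extend E (E := (TangentSpace 𝓘(ℝ, E) : M → Type _)) (Y p)) p := by
  refine hg.eq_of_forall fun z => ?_
  have hX' := mdifferentiableAt_extend 𝓘(ℝ, E) E (X p)
  have hY' := mdifferentiableAt_extend 𝓘(ℝ, E) E (Y p)
  have hz := mdifferentiableAt_extend 𝓘(ℝ, E) E z
  have h := (tensorialAt_koszul_sub_mvfderiv hg hX hz).pointwise hY hY' (by simp)
  have hc : mvfderiv 𝓘(ℝ, E) (components p
      (extend E (E := (TangentSpace 𝓘(ℝ, E) : M → Type _)) (Y p))) p = 0 := by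
    rw [mvfderiv_congr_of_eventuallyEq (components_extend_eventuallyEq (Y p)), mvfderiv_const]
  have hl := koszul_congr_left hg hX hX' hY' hz (by simp)
  have h1 := hg.apply_leviCivita hX hY hz
  have h2 := hg.apply_leviCivita hX' hY' hz
  simp only [extend_apply_self, hc] at h h1 h2
  simp only [zero_apply, map_zero, LinearMap.zero_apply, sub_zero] at h
  rw [LinearMap.BilinForm.add_left, h1, h2, ← hl, ← h]
  ring

end Koszul

/-! ### Lie brackets as commutators of derivations -/

section LieBracket

variable {E : Type*} [NormedAddCommGroup E] [NormedSpace ℝ E]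
  {M : Type*} [TopologicalSpace M] [ChartedSpace E M] [IsManifold 𝓘(ℝ, E) ∞ M]
  {G : Type*} [NormedAddCommGroup G] [NormedSpace ℝ G]

/-- The vector field `V` read in the chart at `p`: its pullback by the inverse of the chart, as a
vector field on the model space. -/
def chartField (p : M) (V : VField E M) : E → E :=
  VectorField.mpullbackWithin 𝓘(ℝ, E) 𝓘(ℝ, E) (extChartAt 𝓘(ℝ, E) p).symm V (range 𝓘(ℝ, E))

theorem chartField_self (p : M) (V : VField E M) :
    chartField p V (extChartAt 𝓘(ℝ, E) p p) = V p := by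
  rw [chartField, VectorField.mpullbackWithin_apply]
  have := mfderivWithin_extChartAt_symm_inverse_apply (I := 𝓘(ℝ, E)) (x := p)
    (V ((extChartAt 𝓘(ℝ, E) p).symm (extChartAt 𝓘(ℝ, E) p p)))
  refine this.trans ?_
  rw [extChartAt_to_inv]

theorem mlieBracket_eq_lieBracket_chartField (p : M) (V W : VField E M) :
    VectorField.mlieBracket 𝓘(ℝ, E) V W p =
      VectorField.lieBracket ℝ (chartField p V) (chartField p W) (extChartAt 𝓘(ℝ, E) p p) := by
  have h : VectorField.mlieBracket 𝓘(ℝ, E) V W p = (ContinuousLinearMap.id ℝ E).inverse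
      (VectorField.lieBracketWithin ℝ (chartField p V) (chartField p W)
        ((extChartAt 𝓘(ℝ, E) p).symm ⁻¹' univ ∩ range 𝓘(ℝ, E)) (extChartAt 𝓘(ℝ, E) p p)) := by
    rw [VectorField.mlieBracket, VectorField.mlieBracketWithin_apply, mfderiv_extChartAt_self]
    rfl
  rw [h, ModelWithCorners.range_eq_univ, preimage_univ, univ_inter,
    VectorField.lieBracketWithin_univ, ContinuousLinearMap.inverse_id]
  rfl

/-- The derivative of `h` along `V` is computed in the chart at `p`. -/
theorem fderiv_chartField_eventuallyEq {h : M → G} {p : M}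
    (hh : ContMDiffAt 𝓘(ℝ, E) 𝓘(ℝ, G) ∞ h p) (V : VField E M) :
    (fun x => fderiv ℝ (h ∘ (extChartAt 𝓘(ℝ, E) p).symm) x (chartField p V x))
      =ᶠ[𝓝 (extChartAt 𝓘(ℝ, E) p p)]
    (fun q => mvfderiv 𝓘(ℝ, E) h q (V q)) ∘ (extChartAt 𝓘(ℝ, E) p).symm := by
  have h1 : ∀ᶠ q in 𝓝 p, MDiffAt h q := by
    have h0 : ContMDiffAt 𝓘(ℝ, E) 𝓘(ℝ, G) 1 h p := hh.of_le (by simp)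
    exact ((contMDiffAt_iff_contMDiffAt_nhds (by simp)).1 h0).mono
      fun q hq => hq.mdifferentiableAt (by simp)
  have h2 : Filter.Tendsto (extChartAt 𝓘(ℝ, E) p).symm (𝓝 (extChartAt 𝓘(ℝ, E) p p)) (𝓝 p) := by
    have := continuousAt_extChartAt_symm (I := 𝓘(ℝ, E)) p
    simpa [ContinuousAt] using this
  filter_upwards [h2.eventually h1, extChartAt_target_mem_nhds (I := 𝓘(ℝ, E)) p] with x hx hxt
  have h3 := mdifferentiableWithinAt_extChartAt_symm (I := 𝓘(ℝ, E)) hxt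
  have h4 := isInvertible_mfderivWithin_extChartAt_symm (I := 𝓘(ℝ, E)) hxt
  have h5 : ∀ L : E →L[ℝ] E, L.IsInvertible → ∀ v : E, L (L.inverse v) = v := by
    rintro _ ⟨e, rfl⟩ v
    rw [ContinuousLinearMap.inverse_equiv]
    exact e.apply_symm_apply v
  have h6 : mfderivWithin 𝓘(ℝ, E) 𝓘(ℝ, E) (extChartAt 𝓘(ℝ, E) p).symm (range 𝓘(ℝ, E)) x
      (chartField (E := E) p V x : E) = V ((extChartAt 𝓘(ℝ, E) p).symm x) := h5 _ h4 _
  simp only [ModelWithCorners.range_eq_univ, mdifferentiableWithinAt_univ, mfderivWithin_univ]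
    at h3 h6
  have h7 := mvfderiv_comp_apply_vector x hx h3 (chartField (E := E) p V x : E)
  rw [h6] at h7
  rw [Function.comp_apply, ← h7, mvfderiv, mfderiv_eq_fderiv]
  rfl

variable [FiniteDimensional ℝ E]

theorem differentiableAt_chartField {p : M} {V : VField E M} (hV : MDiffAt (T% V) p) :
    DifferentiableAt ℝ (chartField p V) (extChartAt 𝓘(ℝ, E) p p) := by
  have h := MDifferentiableWithinAt.differentiableWithinAt_mpullbackWithin_vectorField
    (s := univ) (mdifferentiableWithinAt_univ.2 hV)
  have h' : DifferentiableWithinAt ℝ (chartField p V)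
      ((extChartAt 𝓘(ℝ, E) p).symm ⁻¹' univ ∩ range 𝓘(ℝ, E)) (extChartAt 𝓘(ℝ, E) p p) := h
  rw [ModelWithCorners.range_eq_univ, preimage_univ, univ_inter] at h'
  exact differentiableWithinAt_univ.1 h'

/-- The Lie bracket acts on smooth vector-valued functions as the commutator of derivations. -/
theorem mvfderiv_apply_mlieBracket {h : M → G} {p : M}
    (hh : ContMDiffAt 𝓘(ℝ, E) 𝓘(ℝ, G) ∞ h p) {V W : VField E M}
    (hV : MDiffAt (T% V) p) (hW : MDiffAt (T% W) p) :
    mvfderiv 𝓘(ℝ, E) h p (VectorField.mlieBracket 𝓘(ℝ, E) V W p) =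
      mvfderiv 𝓘(ℝ, E) (fun q => mvfderiv 𝓘(ℝ, E) h q (W q)) p (V p)
        - mvfderiv 𝓘(ℝ, E) (fun q => mvfderiv 𝓘(ℝ, E) h q (V q)) p (W p) := by
  set ψ := extChartAt 𝓘(ℝ, E) p with hψ
  have hh' : ContDiffAt ℝ ∞ (h ∘ ψ.symm) (ψ p) := by
    have := (contMDiffAt_iff.1 hh).2
    rw [ModelWithCorners.range_eq_univ] at this
    exact contDiffWithinAt_univ.1 this
  have hψd : MDiffAt ψ p := mdifferentiableAt_extChartAt (mem_chart_source E p)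
  have hψ' : ∀ u : TangentSpace 𝓘(ℝ, E) p, mfderiv 𝓘(ℝ, E) 𝓘(ℝ, E) ψ p u = u := fun u => by
    rw [hψ, mfderiv_extChartAt_self]; rfl
  -- A function near `p` and its coordinate expression have the same derivative at `p`.
  have key : ∀ k : M → G, DifferentiableAt ℝ (k ∘ ψ.symm) (ψ p) → ∀ u : TangentSpace 𝓘(ℝ, E) p,
      mvfderiv 𝓘(ℝ, E) k p u = fderiv ℝ (k ∘ ψ.symm) (ψ p) u := by
    intro k hk u
    have h1 : k =ᶠ[𝓝 p] (k ∘ ψ.symm) ∘ ψ := by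
      filter_upwards [extChartAt_source_mem_nhds (I := 𝓘(ℝ, E)) p] with q hq
      simp only [Function.comp_apply]
      rw [ψ.left_inv hq]
    rw [mvfderiv_congr_of_eventuallyEq h1,
      mvfderiv_comp_apply_vector p hk.mdifferentiableAt hψd, hψ', mvfderiv, mfderiv_eq_fderiv]
    rfl
  have hd : ∀ {U : VField E M}, MDiffAt (T% U) p →
      DifferentiableAt ℝ ((fun q => mvfderiv 𝓘(ℝ, E) h q (U q)) ∘ ψ.symm) (ψ p) := by
    intro U hU
    refine DifferentiableAt.congr_of_eventuallyEq ?_ (fderiv_chartField_eventuallyEq hh U).symm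
    have h1 := hh'.fderiv_right (m := 1) (by simpa [one_add_one_eq_two] using ENat.LEInfty.out)
    exact (h1.differentiableAt (by simp)).clm_apply (differentiableAt_chartField hU)
  have h1 := VectorField.fderiv_apply_lieBracket hh' (by simpa using ENat.LEInfty.out)
    (differentiableAt_chartField hW) (differentiableAt_chartField hV)
  rw [(fderiv_chartField_eventuallyEq hh W).fderiv_eq,
    (fderiv_chartField_eventuallyEq hh V).fderiv_eq, ← hψ] at h1
  rw [key h (hh'.differentiableAt (by simp)), key _ (hd hV), key _ (hd hW),
    mlieBracket_eq_lieBracket_chartField]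
  refine h1.trans ?_
  rw [hψ, chartField_self, chartField_self]

end LieBracket

/-! ### The induced metric and the Gauss formula -/

section Metric

variable {F : Type*} [NormedAddCommGroup F] [NormedSpace ℝ F]
  {N : Type*} [TopologicalSpace N] [ChartedSpace F N] [IsManifold 𝓘(ℝ, F) ∞ N]
  {E : Type*} [NormedAddCommGroup E] [NormedSpace ℝ E]
  {M : Type*} [TopologicalSpace M] [ChartedSpace E M]

theorem inducedMetric_apply (g : SmoothMetric F N) (ι : M → N) (p : M)
    (u v : TangentSpace 𝓘(ℝ, E) p) :
    inducedMetric g ι p u v = metricForm g (ι p) (mfderiv 𝓘(ℝ, E) 𝓘(ℝ, F) ι p u)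
      (mfderiv 𝓘(ℝ, E) 𝓘(ℝ, F) ι p v) := rfl

/-- The inner product of two differentiable vector fields along a map is differentiable. -/
theorem mdifferentiableAt_metricForm_along (g : SmoothMetric F N) {ι : M → N} {p : M}
    {V W : ∀ q : M, TangentSpace 𝓘(ℝ, F) (ι q)}
    (hV : MDifferentiableAt 𝓘(ℝ, E) (𝓘(ℝ, F).prod 𝓘(ℝ, F))
      (fun q => (TotalSpace.mk' F (E := (TangentSpace 𝓘(ℝ, F) : N → Type _)) (ι q) (V q))) p)
    (hW : MDifferentiableAt 𝓘(ℝ, E) (𝓘(ℝ, F).prod 𝓘(ℝ, F))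
      (fun q => (TotalSpace.mk' F (E := (TangentSpace 𝓘(ℝ, F) : N → Type _)) (ι q) (W q))) p) :
    MDiffAt (fun q => metricForm g (ι q) (V q) (W q)) p := by
  have hb : MDifferentiableAt 𝓘(ℝ, E) 𝓘(ℝ, F) ι p := by
    simp only [mdifferentiableAt_totalSpace] at hV
    exact hV.1
  have h : MDifferentiableAt 𝓘(ℝ, E) (𝓘(ℝ, F).prod 𝓘(ℝ))
      (fun q ↦ TotalSpace.mk' ℝ (E := Bundle.Trivial N ℝ) (ι q) (g.inner (ι q) (V q) (W q))) p := by
    apply MDifferentiableAt.clm_bundle_apply₂ (F₁ := F) (F₂ := F)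
    · exact MDifferentiableAt.comp p (g.contMDiff.mdifferentiableAt (by simp)) hb
    · exact hV
    · exact hW
  simp only [mdifferentiableAt_totalSpace] at h
  exact h.2

theorem isMetricAt_metricForm (g : SmoothMetric F N) (p : N) : IsMetricAt (metricForm g) p where
  symm q u v := g.symm q u v
  pos v hv := g.pos p v hv
  mdiff _ _ hX hY := mdifferentiableAt_metricForm_along (ι := fun q => q) g hX hY

variable [IsManifold 𝓘(ℝ, E) ∞ M]

theorem mdifferentiableAt_mfderiv_apply {ι : M → N} (hι : ContMDiff 𝓘(ℝ, E) 𝓘(ℝ, F) ∞ ι)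
    {V : VField E M} {p : M} (hV : MDiffAt (T% V) p) :
    MDifferentiableAt 𝓘(ℝ, E) (𝓘(ℝ, F).prod 𝓘(ℝ, F))
      (fun q => (TotalSpace.mk' F (E := (TangentSpace 𝓘(ℝ, F) : N → Type _)) (ι q)
        (mfderiv 𝓘(ℝ, E) 𝓘(ℝ, F) ι q (V q)))) p := by
  have h : ContMDiff (𝓘(ℝ, E).prod 𝓘(ℝ, E)) (𝓘(ℝ, F).prod 𝓘(ℝ, F)) 1
      (tangentMap 𝓘(ℝ, E) 𝓘(ℝ, F) ι) :=
    hι.contMDiff_tangentMap (by simpa [one_add_one_eq_two] using ENat.LEInfty.out)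
  exact (h.mdifferentiable (by simp) _).comp p hV

theorem isMetricAt_inducedMetric (g : SmoothMetric F N) {ι : M → N}
    (hι : ContMDiff 𝓘(ℝ, E) 𝓘(ℝ, F) ∞ ι) (p : M)
    (hι' : Function.Injective (mfderiv 𝓘(ℝ, E) 𝓘(ℝ, F) ι p)) :
    IsMetricAt (E := E) (inducedMetric g ι) p where
  symm _ _ _ := g.symm _ _ _
  pos _ hv := g.pos _ _ fun h => hv (hι' (h.trans (map_zero _).symm))
  mdiff _ _ hX hY := mdifferentiableAt_metricForm_along g (mdifferentiableAt_mfderiv_apply hι hX)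
    (mdifferentiableAt_mfderiv_apply hι hY)

end Metric

section Related

variable {F : Type*} [NormedAddCommGroup F] [NormedSpace ℝ F]
  {N : Type*} [TopologicalSpace N] [ChartedSpace F N] [IsManifold 𝓘(ℝ, F) ∞ N]
  {E : Type*} [NormedAddCommGroup E] [NormedSpace ℝ E]
  {M : Type*} [TopologicalSpace M] [ChartedSpace E M] [IsManifold 𝓘(ℝ, E) ∞ M]

/-- The vector field `V` on `M` and the vector field `V'` on `N`, differentiable at `p` and at
`ι p`, are `ι`-related near `p`. -/
structure IsRelatedAt (ι : M → N) (p : M) (V : VField E M) (V' : VField F N) : Prop where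
  mdiff : MDiffAt (T% V) p
  mdiff' : MDiffAt (T% V') (ι p)
  eventually_eq : ∀ᶠ q in 𝓝 p, V' (ι q) = mfderiv 𝓘(ℝ, E) 𝓘(ℝ, F) ι q (V q)

theorem IsRelatedAt.eq {ι : M → N} {p : M} {V : VField E M} {V' : VField F N}
    (h : IsRelatedAt ι p V V') : V' (ι p) = mfderiv 𝓘(ℝ, E) 𝓘(ℝ, F) ι p (V p) :=
  h.eventually_eq.self_of_nhds

theorem mvfderiv_extChartAt_eventuallyEq_components (y : N) (V : VField F N) :
    (fun z => mvfderiv 𝓘(ℝ, F) (extChartAt 𝓘(ℝ, F) y) z (V z)) =ᶠ[𝓝 y] components y V := by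
  filter_upwards [chart_source_mem_nhds F y] with z hz
  rw [components, TangentBundle.continuousLinearMapAt_trivializationAt hz]
  rfl

/-- Along `ι`, the components of a field `V'` related to `V` are the derivatives by `V` of the
coordinate functions pulled back by `ι`. -/
theorem IsRelatedAt.mvfderiv_extChartAt_comp_eventuallyEq {ι : M → N}
    (hι : ContMDiff 𝓘(ℝ, E) 𝓘(ℝ, F) ∞ ι) {p : M} {V : VField E M} {V' : VField F N}
    (hV : IsRelatedAt ι p V V') :
    (fun q => mvfderiv 𝓘(ℝ, E) (extChartAt 𝓘(ℝ, F) (ι p) ∘ ι) q (V q)) =ᶠ[𝓝 p]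
      components (ι p) V' ∘ ι := by
  have hc : Filter.Tendsto ι (𝓝 p) (𝓝 (ι p)) := hι.continuous.continuousAt
  filter_upwards [hc.eventually (mvfderiv_extChartAt_eventuallyEq_components (ι p) V'),
    hV.eventually_eq, hc.eventually (chart_source_mem_nhds F (ι p))] with q hq1 hq2 hq3
  rw [Function.comp_apply, ← hq1, hq2, mvfderiv_comp_apply_vector q
    (mdifferentiableAt_extChartAt hq3) ((hι q).mdifferentiableAt (by simp))]

variable [FiniteDimensional ℝ F]

/-- The covariant derivative along `ι` of `dι V` is the covariant derivative in `N` of any field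
related to `V`. -/
theorem covDerivAlong_eq_leviCivita (g : SmoothMetric F N) {ι : M → N}
    (hι : ContMDiff 𝓘(ℝ, E) 𝓘(ℝ, F) ∞ ι) {p : M} {V : VField E M} {V' X : VField F N}
    (hV : IsRelatedAt ι p V V') {u : TangentSpace 𝓘(ℝ, E) p} (hX : MDiffAt (T% X) (ι p))
    (hXu : X (ι p) = mfderiv 𝓘(ℝ, E) 𝓘(ℝ, F) ι p u) :
    covDerivAlong g ι (fun q => mfderiv 𝓘(ℝ, E) 𝓘(ℝ, F) ι q (V q)) p u =
      leviCivita (metricForm g) X V' (ι p) := by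
  have h1 : (fun q => (trivializationAt F (TangentSpace 𝓘(ℝ, F) : N → Type _)
      (ι p)).continuousLinearMapAt ℝ (ι q) (mfderiv 𝓘(ℝ, E) 𝓘(ℝ, F) ι q (V q))) =ᶠ[𝓝 p]
      components (ι p) V' ∘ ι := by
    filter_upwards [hV.eventually_eq] with q hq
    rw [Function.comp_apply, components, hq]
  rw [leviCivita_eq_mvfderiv_components_add (isMetricAt_metricForm g _) hX hV.mdiff', covDerivAlong,
    mvfderiv_congr_of_eventuallyEq h1, mvfderiv_comp_apply_vector p
    (mdifferentiableAt_components hV.mdiff') ((hι p).mdifferentiableAt (by simp)), hXu, hV.eq]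

variable [FiniteDimensional ℝ E]

/-- An immersion has a differentiable local left inverse. -/
theorem exists_mdifferentiableAt_leftInverse {ι : M → N}
    (hι : ContMDiff 𝓘(ℝ, E) 𝓘(ℝ, F) ∞ ι) (p : M)
    (hι' : Function.Injective (mfderiv 𝓘(ℝ, E) 𝓘(ℝ, F) ι p)) :
    ∃ ρ : N → M, MDifferentiableAt 𝓘(ℝ, F) 𝓘(ℝ, E) ρ (ι p) ∧ ∀ᶠ q in 𝓝 p, ρ (ι q) = q := by
  set ψ := extChartAt 𝓘(ℝ, E) p with hψ
  set k := extChartAt 𝓘(ℝ, F) (ι p) with hk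
  set A : E →L[ℝ] F := mfderiv 𝓘(ℝ, E) 𝓘(ℝ, F) ι p with hA
  -- The coordinate expression of `ι`, projected onto the image of its derivative, is a local
  -- diffeomorphism.
  obtain ⟨L, hL⟩ : ∃ L : F →L[ℝ] E, ∀ v, L (A v) = v := by
    have h0 : LinearMap.ker A.toLinearMap = ⊥ := LinearMap.ker_eq_bot.2 hι'
    obtain ⟨L, hL⟩ := A.toLinearMap.exists_leftInverse_of_injective h0
    exact ⟨LinearMap.toContinuousLinearMap L, fun v => congrArg (fun l => l v) hL⟩
  have h1 : ContDiffAt ℝ ∞ (k ∘ ι ∘ ψ.symm) (ψ p) := by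
    have := (contMDiffAt_iff.1 (hι p)).2
    rw [ModelWithCorners.range_eq_univ] at this
    exact contDiffWithinAt_univ.1 this
  have h2 : HasStrictFDerivAt (k ∘ ι ∘ ψ.symm) A (ψ p) := by
    have h3 : A = fderiv ℝ (k ∘ ι ∘ ψ.symm) (ψ p) := by
      have := ((hι p).mdifferentiableAt (by simp)).mfderiv
      rw [ModelWithCorners.range_eq_univ, fderivWithin_univ] at this
      exact this
    rw [h3]
    exact h1.hasStrictFDerivAt (by simp)
  have h3 : HasStrictFDerivAt (L ∘ k ∘ ι ∘ ψ.symm) (ContinuousLinearEquiv.refl ℝ E : E →L[ℝ] E)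
      (ψ p) := by
    have h4 := L.hasStrictFDerivAt.comp (ψ p) h2
    have h5 : L.comp A = (ContinuousLinearEquiv.refl ℝ E : E →L[ℝ] E) := by
      ext v; exact hL v
    rwa [h5] at h4
  have hp : ψ.symm (ψ p) = p := extChartAt_to_inv p
  have hp' : (L ∘ k ∘ ι ∘ ψ.symm) (ψ p) = L (k (ι p)) := by simp only [Function.comp_apply, hp]
  have h6 := h3.localInverse_apply_image
  rw [hp'] at h6
  refine ⟨fun y => ψ.symm (h3.localInverse _ _ _ (L (k y))), ?_, ?_⟩
  · have hkd : MDiffAt k (ι p) := mdifferentiableAt_extChartAt (mem_chart_source F (ι p))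
    have hLk : MDiffAt (fun y => L (k y)) (ι p) :=
      (L.differentiableAt.comp_mdifferentiableAt hkd :)
    have hσ : DifferentiableAt ℝ (h3.localInverse _ _ _) (L (k (ι p))) := by
      have := h3.to_localInverse.differentiableAt
      rwa [hp'] at this
    have hσk : MDiffAt (fun y => h3.localInverse _ _ _ (L (k y))) (ι p) :=
      DifferentiableAt.comp_mdifferentiableAt (f := fun y => L (k y)) hσ hLk
    have hψs : MDifferentiableAt 𝓘(ℝ, E) 𝓘(ℝ, E) ψ.symm (ψ p) := by
      have := mdifferentiableWithinAt_extChartAt_symm (I := 𝓘(ℝ, E)) (mem_extChartAt_target p)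
      rwa [ModelWithCorners.range_eq_univ, mdifferentiableWithinAt_univ] at this
    exact MDifferentiableAt.comp (ι p) (by rwa [h6]) hσk
  · have h7 := (continuousAt_extChartAt (I := 𝓘(ℝ, E)) p).eventually h3.eventually_left_inverse
    filter_upwards [h7, extChartAt_source_mem_nhds (I := 𝓘(ℝ, E)) p] with q hq hqs
    simp only [Function.comp_apply] at hq
    rw [ψ.left_inv hqs] at hq
    rw [hq, ψ.left_inv hqs]

/-- A vector field on `M` is locally related to a vector field on `N`: take a left inverse `ρ` of
`ι` near `p`, and extend `dι V` to be constant on the fibres of `ρ` in the trivialization at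
`ι p`. -/
theorem exists_isRelatedAt {ι : M → N} (hι : ContMDiff 𝓘(ℝ, E) 𝓘(ℝ, F) ∞ ι) {p : M}
    (hι' : Function.Injective (mfderiv 𝓘(ℝ, E) 𝓘(ℝ, F) ι p)) {V : VField E M}
    (hV : MDiffAt (T% V) p) : ∃ V' : VField F N, IsRelatedAt ι p V V' := by
  obtain ⟨ρ, hρ, hρι⟩ := exists_mdifferentiableAt_leftInverse hι p hι'
  set T := trivializationAt F (TangentSpace 𝓘(ℝ, F) : N → Type _) (ι p) with hT
  have hmem : T.baseSet ∈ 𝓝 (ι p) := T.open_baseSet.mem_nhds (mem_baseSet_trivializationAt F _ _)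
  set w : M → F := fun q => (T (TotalSpace.mk' F (ι q) (mfderiv 𝓘(ℝ, E) 𝓘(ℝ, F) ι q (V q)))).2
    with hw
  have hwd : MDiffAt w p :=
    ((mdifferentiableAt_totalSpace _ _).1 (mdifferentiableAt_mfderiv_apply hι hV)).2
  have hρp : ρ (ι p) = p := hρι.self_of_nhds
  refine ⟨fun y => T.symmL ℝ y (w (ρ y)), hV, ?_, ?_⟩
  · rw [mdifferentiableAt_section]
    have h1 : MDiffAt (fun y => w (ρ y)) (ι p) :=
      MDifferentiableAt.comp (g := w) (ι p) (by rwa [hρp]) hρ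
    refine h1.congr_of_eventuallyEq ?_
    filter_upwards [hmem] with y hy
    have h2 := T.continuousLinearMapAt_symmL (R := ℝ) hy (w (ρ y))
    rwa [Trivialization.continuousLinearMapAt_apply,
      Trivialization.coe_linearMapAt_of_mem _ hy] at h2
  · filter_upwards [hρι, hι.continuous.continuousAt.preimage_mem_nhds hmem] with q hq hqT
    have h2 := T.symmL_continuousLinearMapAt (R := ℝ) hqT (mfderiv 𝓘(ℝ, E) 𝓘(ℝ, F) ι q (V q))
    rw [Trivialization.continuousLinearMapAt_apply,
      Trivialization.coe_linearMapAt_of_mem _ hqT] at h2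
    rw [hq]
    exact h2

/-- The Lie brackets of vector fields related near `p` are related at `p`. Both sides are detected
by their action on a chart of `N`. -/
theorem mfderiv_mlieBracket {ι : M → N} (hι : ContMDiff 𝓘(ℝ, E) 𝓘(ℝ, F) ∞ ι) {p : M}
    {V W : VField E M} {V' W' : VField F N} (hV : IsRelatedAt ι p V V')
    (hW : IsRelatedAt ι p W W') :
    mfderiv 𝓘(ℝ, E) 𝓘(ℝ, F) ι p (VectorField.mlieBracket 𝓘(ℝ, E) V W p) =
      VectorField.mlieBracket 𝓘(ℝ, F) V' W' (ι p) := by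
  have hk : ContMDiffAt 𝓘(ℝ, F) 𝓘(ℝ, F) ∞ (extChartAt 𝓘(ℝ, F) (ι p)) (ι p) :=
    contMDiffAt_extChartAt
  have hιp := (hι p).mdifferentiableAt (n := ∞) (by simp)
  have hself : ∀ v : TangentSpace 𝓘(ℝ, F) (ι p),
      mvfderiv 𝓘(ℝ, F) (extChartAt 𝓘(ℝ, F) (ι p)) (ι p) v = v := fun v => by
    rw [mvfderiv, mfderiv_extChartAt_self]; rfl
  have key : ∀ {X Y : VField E M} {X' Y' : VField F N}, IsRelatedAt ι p X X' →
      IsRelatedAt ι p Y Y' →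
      mvfderiv 𝓘(ℝ, E) (fun q => mvfderiv 𝓘(ℝ, E) (extChartAt 𝓘(ℝ, F) (ι p) ∘ ι) q (Y q)) p (X p) =
      mvfderiv 𝓘(ℝ, F) (fun z => mvfderiv 𝓘(ℝ, F) (extChartAt 𝓘(ℝ, F) (ι p)) z (Y' z)) (ι p)
        (X' (ι p)) := by
    intro X Y X' Y' hX hY
    rw [mvfderiv_congr_of_eventuallyEq (hY.mvfderiv_extChartAt_comp_eventuallyEq hι),
      mvfderiv_congr_of_eventuallyEq (mvfderiv_extChartAt_eventuallyEq_components (ι p) Y'),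
      mvfderiv_comp_apply_vector p (mdifferentiableAt_components hY.mdiff') hιp, hX.eq]
  have h1 := mvfderiv_apply_mlieBracket (hk.comp p (hι p)) hV.mdiff hW.mdiff
  have h2 := mvfderiv_apply_mlieBracket hk hV.mdiff' hW.mdiff'
  rw [key hV hW, key hW hV, ← h2, mvfderiv_comp_apply_vector p (hk.mdifferentiableAt (by simp)) hιp,
    hself, hself] at h1
  exact h1

/-- Koszul form of the Gauss formula: the tangential part of the Levi-Civita connection of `N` is
that of the induced metric. -/
theorem koszul_inducedMetric (g : SmoothMetric F N) {ι : M → N}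
    (hι : ContMDiff 𝓘(ℝ, E) 𝓘(ℝ, F) ∞ ι) {p : M} {U V W : VField E M} {U' V' W' : VField F N}
    (hU : IsRelatedAt ι p U U') (hV : IsRelatedAt ι p V V') (hW : IsRelatedAt ι p W W') :
    koszul (inducedMetric g ι) U V W p = koszul (metricForm g) U' V' W' (ι p) := by
  have hιp := (hι p).mdifferentiableAt (n := ∞) (by simp)
  have key : ∀ {X Y Z : VField E M} {X' Y' Z' : VField F N}, IsRelatedAt ι p X X' →
      IsRelatedAt ι p Y Y' → IsRelatedAt ι p Z Z' →
      mvfderiv 𝓘(ℝ, E) (fun q => inducedMetric g ι q (Y q) (Z q)) p (X p) =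
      mvfderiv 𝓘(ℝ, F) (fun z => metricForm g z (Y' z) (Z' z)) (ι p) (X' (ι p)) := by
    intro X Y Z X' Y' Z' hX hY hZ
    have h1 : (fun q => inducedMetric g ι q (Y q) (Z q)) =ᶠ[𝓝 p]
        (fun z => metricForm g z (Y' z) (Z' z)) ∘ ι := by
      filter_upwards [hY.eventually_eq, hZ.eventually_eq] with q h2 h3
      rw [Function.comp_apply, h2, h3, inducedMetric_apply]
    rw [mvfderiv_congr_of_eventuallyEq h1, mvfderiv_comp_apply_vector p
      ((isMetricAt_metricForm g _).mdiff _ _ hY.mdiff' hZ.mdiff') hιp, hX.eq]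
  unfold koszul
  rw [key hU hV hW, key hV hU hW, key hW hU hV]
  simp only [inducedMetric_apply,
    mfderiv_mlieBracket hι hU hV, mfderiv_mlieBracket hι hU hW, mfderiv_mlieBracket hι hV hW,
    hU.eq, hV.eq, hW.eq]

end Related

/-! ### Orthogonal projections onto smooth distributions -/

section OrthProj

variable {V : Type*} [AddCommGroup V] [Module ℝ V] [FiniteDimensional ℝ V]
  {b : LinearMap.BilinForm ℝ V}

theorem orthProj_mem (hs : ∀ u v, b u v = b v u) (hb : ∀ v, v ≠ 0 → 0 < b v v)
    (W : Submodule ℝ V) (v : V) : orthProj b W v ∈ W := by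
  rw [orthProj, dif_pos (isCompl_orthogonal_of_pos hs hb W)]
  exact Submodule.projection_apply_mem _ _

theorem orthProj_eq_of_mem (hs : ∀ u v, b u v = b v u) (hb : ∀ v, v ≠ 0 → 0 < b v v)
    {W : Submodule ℝ V} {v w : V} (hw : w ∈ W) (h : v - w ∈ b.orthogonal W) :
    orthProj b W v = w := by
  have hc := isCompl_orthogonal_of_pos hs hb W
  rw [orthProj, dif_pos hc]
  have h1 := (Submodule.projection_apply_eq_zero_iff hc).2 h
  rw [map_sub, Submodule.projection_apply_of_mem_left hc hw, sub_eq_zero] at h1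
  exact h1

theorem sub_orthProj_mem (hs : ∀ u v, b u v = b v u) (hb : ∀ v, v ≠ 0 → 0 < b v v)
    (W : Submodule ℝ V) (v : V) : v - orthProj b W v ∈ b.orthogonal W := by
  have hc := isCompl_orthogonal_of_pos hs hb W
  rw [orthProj, dif_pos hc, ← Submodule.projection_apply_eq_zero_iff hc, map_sub,
    Submodule.projection_apply_of_mem_left hc (Submodule.projection_apply_mem hc v), sub_self]

theorem apply_orthProj_left (hs : ∀ u v, b u v = b v u) (hb : ∀ v, v ≠ 0 → 0 < b v v)
    {W : Submodule ℝ V} {w : V} (hw : w ∈ W) (v : V) : b (orthProj b W v) w = b v w := by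
  have h : b w (v - orthProj b W v) = 0 := sub_orthProj_mem hs hb W v w hw
  rw [hs _ w, hs v w]
  rw [map_sub] at h
  linarith

theorem orthogonal_orthogonal_of_pos (hs : ∀ u v, b u v = b v u) (hb : ∀ v, v ≠ 0 → 0 < b v v)
    (W : Submodule ℝ V) : b.orthogonal (b.orthogonal W) = W := by
  refine le_antisymm (fun v hv => ?_) (LinearMap.BilinForm.le_orthogonal_orthogonal
    fun u v h => by rw [hs, h])
  have h1 := sub_orthProj_mem hs hb W v
  have h2 : b (v - orthProj b W v) v = 0 := hv _ h1
  have h3 : b (orthProj b W v) (v - orthProj b W v) = 0 := h1 _ (orthProj_mem hs hb W v)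
  have h4 : v - orthProj b W v = 0 := by
    by_contra hne
    refine (hb _ hne).ne' ?_
    rw [LinearMap.BilinForm.sub_right, h2, hs _ (orthProj b W v), h3, sub_zero]
  rw [sub_eq_zero.1 h4]
  exact orthProj_mem hs hb W v

theorem orthProj_orthogonal (hs : ∀ u v, b u v = b v u) (hb : ∀ v, v ≠ 0 → 0 < b v v)
    (W : Submodule ℝ V) (v : V) : orthProj b (b.orthogonal W) v = v - orthProj b W v := by
  refine orthProj_eq_of_mem hs hb (sub_orthProj_mem hs hb W v) ?_
  rw [orthogonal_orthogonal_of_pos hs hb, sub_sub_cancel]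
  exact orthProj_mem hs hb W v

/-- Let `T` be a subspace and `P` a subspace of its orthogonal complement. Then the sum of `T` and
of the orthogonal complement of `P` in `T^⊥` is the orthogonal complement of `P`. -/
theorem sup_orthogonal_inf_orthogonal (hs : ∀ u v, b u v = b v u) (hb : ∀ v, v ≠ 0 → 0 < b v v)
    {T P : Submodule ℝ V} (hP : P ≤ b.orthogonal T) :
    T ⊔ b.orthogonal T ⊓ b.orthogonal P = b.orthogonal P := by
  have hT : T ≤ b.orthogonal P := fun t ht n hn => (hs n t).trans (hP hn t ht)
  rw [← sup_inf_assoc_of_le _ hT, (isCompl_orthogonal_of_pos hs hb T).sup_eq_top, top_inf_eq]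

end OrthProj

section Distribution

variable {E : Type*} [NormedAddCommGroup E] [NormedSpace ℝ E]
  {M : Type*} [TopologicalSpace M] [ChartedSpace E M]

theorem mdifferentiableAt_det {k : ℕ} {A : M → Matrix (Fin k) (Fin k) ℝ} {p : M}
    (hA : ∀ i j, MDiffAt (fun q => A q i j) p) : MDiffAt (fun q => (A q).det) p := by
  simp only [Matrix.det_apply]
  have h : ∀ σ : Equiv.Perm (Fin k),
      MDiffAt (fun q => Equiv.Perm.sign σ • ∏ i, A q (σ i) i) p := by
    intro σ
    have h1 : MDiffAt (∏ i, fun q => A q (σ i) i) p := MDifferentiableAt.prod fun i _ => hA _ _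
    have h2 := h1.const_smul ((Equiv.Perm.sign σ : ℤ) : ℝ)
    refine h2.congr_of_eventuallyEq (Filter.Eventually.of_forall fun q => ?_)
    simp [Finset.prod_apply, Units.smul_def]
  have h3 : MDiffAt (∑ σ : Equiv.Perm (Fin k), fun q =>
      Equiv.Perm.sign σ • ∏ i, A q (σ i) i) p := MDifferentiableAt.sum fun σ _ => h σ
  refine h3.congr_of_eventuallyEq (Filter.Eventually.of_forall fun q => ?_)
  simp [Finset.sum_apply]

theorem mdifferentiableAt_matrix_inv {k : ℕ} {A : M → Matrix (Fin k) (Fin k) ℝ} {p : M}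
    (hA : ∀ i j, MDiffAt (fun q => A q i j) p) (hdet : (A p).det ≠ 0) (i j : Fin k) :
    MDiffAt (fun q => (A q)⁻¹ i j) p := by
  have h1 : MDiffAt (fun q => ((A q).det)⁻¹) p :=
    DifferentiableAt.comp_mdifferentiableAt (f := fun q => (A q).det) (differentiableAt_inv hdet)
      (mdifferentiableAt_det hA)
  have h2 : MDiffAt (fun q => (A q).adjugate i j) p := by
    simp only [Matrix.adjugate_apply]
    refine mdifferentiableAt_det fun i' j' => ?_
    rcases eq_or_ne i' j with rfl | h
    · simpa [Matrix.updateRow_self] using mdifferentiableAt_const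
    · simpa [Matrix.updateRow_ne h] using hA i' j'
  refine (h1.mul h2).congr_of_eventuallyEq (Filter.Eventually.of_forall fun q => ?_)
  simp [Matrix.inv_def]

/-- The Gram matrix of a linearly independent family is invertible. -/
theorem det_gram_ne_zero {V : Type*} [AddCommGroup V] [Module ℝ V] {b : LinearMap.BilinForm ℝ V}
    (hb : ∀ v, v ≠ 0 → 0 < b v v) {k : ℕ} {x : Fin k → V} (hx : LinearIndependent ℝ x) :
    (Matrix.of fun i j => b (x i) (x j)).det ≠ 0 := by
  rw [← isUnit_iff_ne_zero, ← Matrix.isUnit_iff_isUnit_det, ← Matrix.mulVec_injective_iff_isUnit,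
    ← Matrix.coe_mulVecLin, injective_iff_map_eq_zero]
  intro c hc
  have h1 : ∀ i, b (x i) (∑ j, c j • x j) = 0 := fun i => by
    have := congrFun hc i
    simpa [Matrix.mulVec, dotProduct, mul_comm] using this
  have h2 : ∑ j, c j • x j = 0 := by
    by_contra hne
    refine (hb _ hne).ne' ?_
    rw [LinearMap.BilinForm.sum_left]
    exact Finset.sum_eq_zero fun i _ => by rw [LinearMap.BilinForm.smul_left, h1, mul_zero]
  exact funext (Fintype.linearIndependent_iff.1 hx c h2)

variable [FiniteDimensional ℝ E] [IsManifold 𝓘(ℝ, E) ∞ M]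

/-- The orthogonal projection of a differentiable vector field to a smooth distribution is
differentiable: in a local frame of the distribution, its coefficients are given by the inverse of
the Gram matrix. -/
theorem mdifferentiableAt_orthProj {g : BilinField E M} (hg : ∀ p, IsMetricAt g p)
    {D : SubspaceField E M} (hD : IsSmoothDistribution D) {X : VField E M} {p : M}
    (hX : MDiffAt (T% X) p) : MDiffAt (T% (fun q => orthProj (g q) (D q) (X q))) p := by
  obtain ⟨U, hU, hpU, k, x, hx, hxD⟩ := hD p
  have hxd : ∀ i, MDiffAt (T% (x i)) p := fun i =>
    ((hx i).contMDiffAt (hU.mem_nhds hpU)).mdifferentiableAt (by simp)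
  set G : M → Matrix (Fin k) (Fin k) ℝ := fun q => Matrix.of fun i j => g q (x i q) (x j q) with hG
  set c : Fin k → M → ℝ := fun j q => ∑ i, (G q)⁻¹ j i * g q (x i q) (X q) with hc
  have hdet : ∀ q ∈ U, (G q).det ≠ 0 := fun q hq => det_gram_ne_zero (hg q).pos (hxD q hq).1
  have hcd : ∀ j, MDiffAt (c j) p := by
    intro j
    have h1 : ∀ i, MDiffAt (fun q => (G q)⁻¹ j i * g q (x i q) (X q)) p := fun i =>
      (mdifferentiableAt_matrix_inv (fun i j => (hg p).mdiff _ _ (hxd i) (hxd j)) (hdet p hpU)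
        j i).mul ((hg p).mdiff _ _ (hxd i) hX)
    have h2 : MDiffAt (∑ i, fun q => (G q)⁻¹ j i * g q (x i q) (X q)) p :=
      MDifferentiableAt.sum fun i _ => h1 i
    refine h2.congr_of_eventuallyEq (Filter.Eventually.of_forall fun q => ?_)
    simp [hc, Finset.sum_apply]
  have h3 : MDiffAt (T% (fun q => ∑ j, c j q • x j q)) p :=
    .sum_section fun j _ => (hcd j).smul_section (hxd j)
  refine h3.congr_of_eventuallyEq ?_
  filter_upwards [hU.mem_nhds hpU] with q hq
  have hfin : FiniteDimensional ℝ (TangentSpace 𝓘(ℝ, E) q) :=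
    inferInstanceAs (FiniteDimensional ℝ E)
  have hmem : ∀ j, x j q ∈ D q := fun j => (hxD q hq).2 ▸ Submodule.subset_span ⟨j, rfl⟩
  congr 1
  refine orthProj_eq_of_mem ((hg q).symm q) (hg q).pos
    (Submodule.sum_mem _ fun j _ => Submodule.smul_mem _ _ (hmem j)) ?_
  have h4 : D q ≤ LinearMap.ker ((g q).flip (X q - ∑ j, c j q • x j q)) := by
    rw [← (hxD q hq).2, Submodule.span_le]
    rintro _ ⟨i, rfl⟩
    have h5 : ∑ j, G q i j * c j q = g q (x i q) (X q) := by
      have h6 : (G q).mulVec ((G q)⁻¹.mulVec fun i => g q (x i q) (X q)) =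
          fun i => g q (x i q) (X q) := by
        rw [Matrix.mulVec_mulVec, Matrix.mul_nonsing_inv _ (isUnit_iff_ne_zero.2 (hdet q hq)),
          Matrix.one_mulVec]
      exact congrFun h6 i
    have h7 : g q (x i q) (X q - ∑ j, c j q • x j q) = 0 := by
      rw [LinearMap.BilinForm.sub_right, ← h5, LinearMap.BilinForm.sum_right, sub_eq_zero]
      exact Finset.sum_congr rfl fun j _ => by simp [hG, mul_comm]
    exact h7
  exact fun n hn => h4 hn

variable [T2Space M]

/-- A vector field that is smooth on a neighbourhood `U` of `p` agrees at `p` with a global smooth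
vector field that is a multiple of it on `U` and vanishes outside of `U`. -/
theorem exists_isSmoothField_of_contMDiffOn {U : Set M} (hU : IsOpen U) {p : M} (hp : p ∈ U)
    {Y : VField E M} (hY : ContMDiffOn 𝓘(ℝ, E) (𝓘(ℝ, E).prod 𝓘(ℝ, E)) ∞ (T% Y) U) :
    ∃ X : VField E M, IsSmoothField X ∧ (∀ q ∈ U, ∃ c : ℝ, X q = c • Y q) ∧ (∀ q ∉ U, X q = 0) ∧
      X p = Y p := by
  obtain ⟨f, hf, -⟩ := (SmoothBumpFunction.nhds_basis_support (I := 𝓘(ℝ, E))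
    (hU.mem_nhds hp)).mem_iff.1 Filter.univ_mem
  refine ⟨(f : M → ℝ) • Y, ContMDiffOn.smul_section_of_tsupport f.contMDiff.contMDiffOn hU hf hY,
    fun q _ => ⟨f q, rfl⟩, fun q hq => ?_, ?_⟩
  · have : f q = 0 := image_eq_zero_of_notMem_tsupport fun h => hq (hf h)
    simp [this]
  · simp

/-- Every vector of a smooth distribution extends to a global smooth section of it. -/
theorem IsSmoothDistribution.exists_isSmoothField {D : SubspaceField E M}
    (hD : IsSmoothDistribution D) {p : M} {v : TangentSpace 𝓘(ℝ, E) p} (hv : v ∈ D p) :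
    ∃ X : VField E M, IsSmoothField X ∧ (∀ q, X q ∈ D q) ∧ X p = v := by
  obtain ⟨U, hU, hpU, k, x, hx, hxD⟩ := hD p
  rw [← (hxD p hpU).2, Submodule.mem_span_range_iff_exists_fun] at hv
  obtain ⟨c, hc⟩ := hv
  have hs : ContMDiffOn 𝓘(ℝ, E) (𝓘(ℝ, E).prod 𝓘(ℝ, E)) ∞ (T% (fun q => ∑ i, c i • x i q)) U :=
    .sum_section fun i _ => contMDiffOn_const.smul_section (hx i)
  obtain ⟨X, hX, h1, h2, h3⟩ := exists_isSmoothField_of_contMDiffOn hU hpU hs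
  refine ⟨X, hX, fun q => ?_, h3.trans hc⟩
  by_cases hq : q ∈ U
  · obtain ⟨t, ht⟩ := h1 q hq
    rw [ht]
    exact Submodule.smul_mem _ _ (Submodule.sum_mem _ fun i _ => Submodule.smul_mem _ _
      ((hxD q hq).2 ▸ Submodule.subset_span ⟨i, rfl⟩))
  · rw [h2 q hq]
    exact Submodule.zero_mem _

theorem exists_isSmoothField {p : M} (v : TangentSpace 𝓘(ℝ, E) p) :
    ∃ X : VField E M, IsSmoothField X ∧ X p = v := by
  obtain ⟨s, hs, h⟩ := exists_contMDiffOn_extend (k := ∞) 𝓘(ℝ, E) E v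
  obtain ⟨U, hUs, hU, hpU⟩ := mem_nhds_iff.1 hs
  obtain ⟨X, hX, -, -, h1⟩ := exists_isSmoothField_of_contMDiffOn hU hpU (h.mono hUs)
  exact ⟨X, hX, h1.trans (extend_apply_self E v)⟩

end Distribution

/-! ### Locally conformal Kähler manifolds and the second fundamental form -/

section LCK

variable {F : Type*} [NormedAddCommGroup F] [NormedSpace ℝ F]
  {N : Type*} [TopologicalSpace N] [ChartedSpace F N] [IsManifold 𝓘(ℝ, F) ∞ N]
  {g : SmoothMetric F N} {J : EndField F N}

theorem IsAlmostHermitian.apply_right (hH : IsAlmostHermitian g J) (p : N)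
    (u v : TangentSpace 𝓘(ℝ, F) p) :
    metricForm g p u (J p v) = -metricForm g p (J p u) v := by
  have h := hH.hermitian p u (J p v)
  rw [hH.sq, map_neg] at h
  exact h.symm

theorem IsAlmostHermitian.apply_apply (hH : IsAlmostHermitian g J) (p : N)
    (u v : TangentSpace 𝓘(ℝ, F) p) :
    metricForm g p (J p u) (J p v) = metricForm g p u v :=
  hH.hermitian p u v

theorem IsAlmostHermitian.mdifferentiableAt (hH : IsAlmostHermitian g J) {p : N} {Y : VField F N}
    (hY : MDiffAt (T% Y) p) : MDiffAt (T% (fun q => J q (Y q))) p := by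
  apply MDifferentiableAt.clm_bundle_apply (F₁ := F) (F₂ := F)
  · exact hH.smooth.mdifferentiableAt (by simp)
  · exact hY

/-- The exterior derivative of the Kähler form is the alternating sum of its covariant
derivatives. -/
theorem IsLeeForm.eq_koszul {lee : CovectorField F N} (hL : IsLeeForm g J lee) {p : N}
    {X Y Z : VField F N} (hX : MDiffAt (T% X) p) (hY : MDiffAt (T% Y) p) (hZ : MDiffAt (T% Z) p) :
    lee p (X p) * metricForm g p (Y p) (J p (Z p)) + lee p (Y p) * metricForm g p (Z p) (J p (X p))
      + lee p (Z p) * metricForm g p (X p) (J p (Y p)) =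
    koszul (metricForm g) X (fun q => J q (Z q)) Y p
        + koszul (metricForm g) X Z (fun q => J q (Y q)) p
      - (koszul (metricForm g) Y (fun q => J q (Z q)) X p
        + koszul (metricForm g) Y Z (fun q => J q (X q)) p)
      + (koszul (metricForm g) Z (fun q => J q (Y q)) X p
        + koszul (metricForm g) Z Y (fun q => J q (X q)) p) := by
  have hs := (isMetricAt_metricForm g p).symm
  refine (hL.d_kahlerForm p X Y Z hX hY hZ).symm.trans ?_
  have h1 := koszul_add_koszul_swap (p := p) hs X Y (fun q => J q (Z q))
  have h2 := koszul_add_koszul_swap (p := p) hs Y X (fun q => J q (Z q))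
  have h3 := koszul_add_koszul_swap (p := p) hs Z X (fun q => J q (Y q))
  have h4 := koszul_sub_koszul_swap (p := p) hs X Y (fun q => J q (Z q))
  have h5 := koszul_sub_koszul_swap (p := p) hs X Z (fun q => J q (Y q))
  have h6 := koszul_sub_koszul_swap (p := p) hs Y Z (fun q => J q (X q))
  change mvfderiv 𝓘(ℝ, F) (fun q => metricForm g q (Y q) (J q (Z q))) p (X p)
      - mvfderiv 𝓘(ℝ, F) (fun q => metricForm g q (X q) (J q (Z q))) p (Y p)
      + mvfderiv 𝓘(ℝ, F) (fun q => metricForm g q (X q) (J q (Y q))) p (Z p)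
      - metricForm g p (VectorField.mlieBracket 𝓘(ℝ, F) X Y p) (J p (Z p))
      + metricForm g p (VectorField.mlieBracket 𝓘(ℝ, F) X Z p) (J p (Y p))
      - metricForm g p (VectorField.mlieBracket 𝓘(ℝ, F) Y Z p) (J p (X p)) = _
  linarith

variable [FiniteDimensional ℝ F]

theorem koszul_neg_right (g : SmoothMetric F N) {p : N} {X Y Z : VField F N}
    (hX : MDiffAt (T% X) p) (hY : MDiffAt (T% Y) p) (hZ : MDiffAt (T% Z) p) :
    koszul (metricForm g) X Y (fun q => -Z q) p = -koszul (metricForm g) X Y Z p := by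
  have hg := isMetricAt_metricForm g p
  have h := (tensorialAt_koszul (hg.symm p) hg.mdiff hX hY).smul (f := fun _ : N => (-1 : ℝ))
    mdifferentiableAt_const hZ
  have e : (fun _ : N => (-1 : ℝ)) • Z = fun q => -Z q := by ext q; simp
  rw [e] at h
  simpa using h

/-- If `exp (-f) g` is Kähler, then `g((∇_X J) Y, Z)`, which is the left-hand side, is determined by
`df`. -/
theorem koszul_apply_left_add_koszul_apply_right (hH : IsAlmostHermitian g J) {U : Set N}
    {f : N → ℝ} (hK : IsKahlerOn (fun q => Real.exp (-f q) • metricForm g q) J U) {p : N}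
    (hp : p ∈ U) (hf : MDiffAt f p) {X Y Z : VField F N}
    (hX : MDiffAt (T% X) p) (hY : MDiffAt (T% Y) p) (hZ : MDiffAt (T% Z) p) :
    koszul (metricForm g) X (fun q => J q (Y q)) Z p
        + koszul (metricForm g) X Y (fun q => J q (Z q)) p =
      (1 / 2) * (mvfderiv 𝓘(ℝ, F) f p (J p (Y p)) * metricForm g p (X p) (Z p)
        - mvfderiv 𝓘(ℝ, F) f p (Z p) * metricForm g p (X p) (J p (Y p))
        + mvfderiv 𝓘(ℝ, F) f p (Y p) * metricForm g p (X p) (J p (Z p))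
        - mvfderiv 𝓘(ℝ, F) f p (J p (Z p)) * metricForm g p (X p) (Y p)) := by
  have hg := isMetricAt_metricForm g p
  have hJY := hH.mdifferentiableAt hY
  have hJZ := hH.mdifferentiableAt hZ
  have h1 := (hg.exp_smul hf).apply_leviCivita hX hJY hZ
  have h2 := (hg.exp_smul hf).apply_leviCivita hX hY hJZ
  rw [hK p hp X Y hX hY] at h1
  simp only [LinearMap.smul_apply, smul_eq_mul] at h1 h2
  rw [hH.apply_right] at h2
  have h3 := koszul_exp_smul hg hf hX hJY hZ
  have h4 := koszul_exp_smul hg hf hX hY hJZ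
  rw [← h1] at h3
  rw [← h2] at h4
  have he := (Real.exp_pos (-f p)).ne'
  have h5 := mul_left_cancel₀ he h3
  rw [mul_neg, ← mul_neg] at h4
  have h6 := mul_left_cancel₀ he h4
  rw [hH.apply_right p (Y p)] at h6
  linarith

/-- On vectors orthogonal to a non-zero vector `u` and to `J u`, the Lee form is the differential of
the logarithm of the conformal factor. -/
theorem IsLeeForm.apply_mul_eq (hH : IsAlmostHermitian g J) {U : Set N}
    {f : N → ℝ} (hK : IsKahlerOn (fun q => Real.exp (-f q) • metricForm g q) J U) {p : N}
    (hp : p ∈ U) (hf : MDiffAt f p) {lee : CovectorField F N} (hL : IsLeeForm g J lee)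
    {u x : TangentSpace 𝓘(ℝ, F) p} (h : metricForm g p x u = 0) (h' : metricForm g p x (J p u) = 0)
    (v : TangentSpace 𝓘(ℝ, F) p) :
    lee p x * metricForm g p u v = mvfderiv 𝓘(ℝ, F) f p x * metricForm g p u v := by
  have hs := (isMetricAt_metricForm g p).symm p
  rcases eq_or_ne u 0 with rfl | hu
  · simp
  have hX := mdifferentiableAt_extend 𝓘(ℝ, F) F x
  have hY := mdifferentiableAt_extend 𝓘(ℝ, F) F u
  have hZ := mdifferentiableAt_extend 𝓘(ℝ, F) F (J p u)
  have h1 := hL.eq_koszul hX hY hZ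
  rw [koszul_apply_left_add_koszul_apply_right hH hK hp hf hX hZ hY,
    koszul_apply_left_add_koszul_apply_right hH hK hp hf hY hZ hX,
    koszul_apply_left_add_koszul_apply_right hH hK hp hf hZ hY hX] at h1
  simp only [extend_apply_self, hH.sq, map_neg, hH.apply_apply, h, h', hs u x,
    hs (J p u) x, hs (J p u) u] at h1
  have h2 : metricForm g p u (J p x) = 0 := by rw [hH.apply_right, hs, h', neg_zero]
  rw [h2] at h1
  have h3 : (lee p x - mvfderiv 𝓘(ℝ, F) f p x) * metricForm g p u u = 0 := by linarith
  have h4 := (mul_eq_zero.1 h3).resolve_right ((isMetricAt_metricForm g p).pos u hu).ne'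
  rw [sub_eq_zero.1 h4]

theorem apply_antiLeeField (hH : IsAlmostHermitian g J) (lee : CovectorField F N) {p : N}
    (x : TangentSpace 𝓘(ℝ, F) p) :
    metricForm g p (antiLeeField g J lee p) (J p x) = -lee p x := by
  have : FiniteDimensional ℝ (TangentSpace 𝓘(ℝ, F) p) := inferInstanceAs (FiniteDimensional ℝ F)
  rw [antiLeeField, LinearMap.BilinForm.neg_left, hH.apply_apply, leeField,
    apply_sharp (isMetricAt_metricForm g p).pos]
  rfl

end LCK

section SecondFundamentalForm

variable {F : Type*} [NormedAddCommGroup F] [NormedSpace ℝ F] [FiniteDimensional ℝ F]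
  {N : Type*} [TopologicalSpace N] [ChartedSpace F N] [IsManifold 𝓘(ℝ, F) ∞ N]
  {E : Type*} [NormedAddCommGroup E] [NormedSpace ℝ E] [FiniteDimensional ℝ E]
  {M : Type*} [TopologicalSpace M] [ChartedSpace E M] [IsManifold 𝓘(ℝ, E) ∞ M]
  {g : SmoothMetric F N} {J : EndField F N} {ι : M → N} {p : M}

/-- The Weingarten equation, in Koszul form: the pairing of the second fundamental form with a
normal field. -/
theorem apply_secondFundamentalForm (hι : ContMDiff 𝓘(ℝ, E) 𝓘(ℝ, F) ∞ ι)
    {u v : TangentSpace 𝓘(ℝ, E) p} {X Y ν : VField F N} (hX : MDiffAt (T% X) (ι p))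
    (hXu : X (ι p) = mfderiv 𝓘(ℝ, E) 𝓘(ℝ, F) ι p u) (hY : MDiffAt (T% Y) (ι p))
    (hYv : Y (ι p) = mfderiv 𝓘(ℝ, E) 𝓘(ℝ, F) ι p v) (hν : MDiffAt (T% ν) (ι p))
    (hνn : ∀ᶠ q in 𝓝 p, ∀ w : TangentSpace 𝓘(ℝ, E) q,
      metricForm g (ι q) (mfderiv 𝓘(ℝ, E) 𝓘(ℝ, F) ι q w) (ν (ι q)) = 0)
    (hι' : Function.Injective (mfderiv 𝓘(ℝ, E) 𝓘(ℝ, F) ι p)) :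
    metricForm g (ι p) (secondFundamentalForm g ι p u v) (ν (ι p)) =
      -koszul (metricForm g) X ν Y (ι p) := by
  have hg := isMetricAt_metricForm g (ι p)
  obtain ⟨W, hW⟩ := exists_isRelatedAt hι hι' (mdifferentiableAt_extend 𝓘(ℝ, E) E v)
  have h0 : W (ι p) = Y (ι p) := by rw [hW.eq, hYv, extend_apply_self]
  rw [secondFundamentalForm, LinearMap.BilinForm.sub_left, hνn.self_of_nhds, sub_zero,
    covDerivAlong_eq_leviCivita g hι hW hX hXu, hg.apply_leviCivita hX hW.mdiff' hν,
    koszul_congr_right hg hX hν hY hW.mdiff' h0.symm, eq_neg_iff_add_eq_zero,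
    koszul_add_koszul_swap hg.symm, hXu]
  -- The inner product of `W` and `ν` vanishes along `ι`.
  have h1 : (fun q => metricForm g q (W q) (ν q)) ∘ ι =ᶠ[𝓝 p] fun _ => (0 : ℝ) := by
    filter_upwards [hνn, hW.eventually_eq] with q h1 h2
    rw [Function.comp_apply, h2, h1]
  rw [← mvfderiv_comp_apply_vector p (hg.mdiff _ _ hW.mdiff' hν)
    ((hι p).mdifferentiableAt (by simp)), mvfderiv_congr_of_eventuallyEq h1, mvfderiv_const]
  rfl

/-- Let `n = J (dι ξ)` be a normal field along the submanifold. If `w = J z` is tangent, the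
pairing of `h(u, w)` with `n` can be computed by means of the Levi-Civita connection of the
submanifold. -/
theorem apply_secondFundamentalForm_of_eq (hH : IsAlmostHermitian g J) {U : Set N}
    {f : N → ℝ} (hK : IsKahlerOn (fun q => Real.exp (-f q) • metricForm g q) J U)
    (hp : ι p ∈ U) (hf : MDiffAt f (ι p)) (hι : ContMDiff 𝓘(ℝ, E) 𝓘(ℝ, F) ∞ ι)
    (hι' : Function.Injective (mfderiv 𝓘(ℝ, E) 𝓘(ℝ, F) ι p)) {X ξ Z : VField E M}
    (hX : MDiffAt (T% X) p) (hξ : MDiffAt (T% ξ) p) (hZ : MDiffAt (T% Z) p)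
    (hn : ∀ᶠ q in 𝓝 p, ∀ w : TangentSpace 𝓘(ℝ, E) q,
      metricForm g (ι q) (mfderiv 𝓘(ℝ, E) 𝓘(ℝ, F) ι q w)
        (J (ι q) (mfderiv 𝓘(ℝ, E) 𝓘(ℝ, F) ι q (ξ q))) = 0)
    (hXξ : inducedMetric g ι p (X p) (ξ p) = 0) {w : TangentSpace 𝓘(ℝ, E) p}
    (hw : mfderiv 𝓘(ℝ, E) 𝓘(ℝ, F) ι p w = J (ι p) (mfderiv 𝓘(ℝ, E) 𝓘(ℝ, F) ι p (Z p))) :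
    metricForm g (ι p) (secondFundamentalForm g ι p (X p) w)
        (J (ι p) (mfderiv 𝓘(ℝ, E) 𝓘(ℝ, F) ι p (ξ p))) =
      -koszul (inducedMetric g ι) X ξ Z p
        + (1 / 2) * (mvfderiv 𝓘(ℝ, F) f (ι p) (mfderiv 𝓘(ℝ, E) 𝓘(ℝ, F) ι p (ξ p)) *
            inducedMetric g ι p (X p) (Z p)
          - mvfderiv 𝓘(ℝ, F) f (ι p) (J (ι p) (mfderiv 𝓘(ℝ, E) 𝓘(ℝ, F) ι p (ξ p))) *
            inducedMetric g ι p (X p) w) := by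
  obtain ⟨X', hX'⟩ := exists_isRelatedAt hι hι' hX
  obtain ⟨ξ', hξ'⟩ := exists_isRelatedAt hι hι' hξ
  obtain ⟨Z', hZ'⟩ := exists_isRelatedAt hι hι' hZ
  have hJξ := hH.mdifferentiableAt hξ'.mdiff'
  have hJZ := hH.mdifferentiableAt hZ'.mdiff'
  have hn' : ∀ᶠ q in 𝓝 p, ∀ w : TangentSpace 𝓘(ℝ, E) q,
      metricForm g (ι q) (mfderiv 𝓘(ℝ, E) 𝓘(ℝ, F) ι q w) (J (ι q) (ξ' (ι q))) = 0 := by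
    filter_upwards [hn, hξ'.eventually_eq] with q h1 h2
    rwa [h2]
  have h1 := apply_secondFundamentalForm (v := w) hι hX'.mdiff' hX'.eq hJZ
    (by rw [hZ'.eq, hw]) hJξ hn' hι'
  have h2 := koszul_apply_left_add_koszul_apply_right hH hK hp hf hX'.mdiff' hξ'.mdiff' hJZ
  have h3 : (fun q => J q (J q (Z' q))) = fun q => -Z' q := funext fun q => hH.sq q _
  rw [h3, koszul_neg_right g hX'.mdiff' hξ'.mdiff' hZ'.mdiff',
    ← koszul_inducedMetric g hι hX' hξ' hZ'] at h2
  have h4 : J (ι p) (mfderiv 𝓘(ℝ, E) 𝓘(ℝ, F) ι p w) = -mfderiv 𝓘(ℝ, E) 𝓘(ℝ, F) ι p (Z p) := by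
    rw [hw, hH.sq]
  simp only [hX'.eq, hξ'.eq, hZ'.eq, ← hw, h4, map_neg, hn.self_of_nhds] at h1 h2
  simp only [← inducedMetric_apply, hXξ] at h2
  linarith

/-- The component in the direction `J ξ`, for `ξ ∈ D^⊥`, of the vector
`g(X, Y) A + h(X, J Y) + h(Y, J X)` is minus the symmetric part of `g(∇_X ξ, Y)`: the derivative of
the conformal factor in the direction `ξ` is cancelled by the Lee form. -/
theorem apply_smul_antiLeeField_add_secondFundamentalForm (hH : IsAlmostHermitian g J)
    (hK : IsLCK g J) {lee : CovectorField F N} (hL : IsLeeForm g J lee)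
    (hι : ContMDiff 𝓘(ℝ, E) 𝓘(ℝ, F) ∞ ι)
    (hι' : Function.Injective (mfderiv 𝓘(ℝ, E) 𝓘(ℝ, F) ι p)) {X ξ Y : VField E M}
    (hX : MDiffAt (T% X) p) (hξ : MDiffAt (T% ξ) p) (hY : MDiffAt (T% Y) p)
    (hn : ∀ᶠ q in 𝓝 p, ∀ w : TangentSpace 𝓘(ℝ, E) q,
      metricForm g (ι q) (mfderiv 𝓘(ℝ, E) 𝓘(ℝ, F) ι q w)
        (J (ι q) (mfderiv 𝓘(ℝ, E) 𝓘(ℝ, F) ι q (ξ q))) = 0)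
    (hXξ : inducedMetric g ι p (X p) (ξ p) = 0) (hYξ : inducedMetric g ι p (Y p) (ξ p) = 0)
    {x y : TangentSpace 𝓘(ℝ, E) p}
    (hx : mfderiv 𝓘(ℝ, E) 𝓘(ℝ, F) ι p x = J (ι p) (mfderiv 𝓘(ℝ, E) 𝓘(ℝ, F) ι p (X p)))
    (hy : mfderiv 𝓘(ℝ, E) 𝓘(ℝ, F) ι p y = J (ι p) (mfderiv 𝓘(ℝ, E) 𝓘(ℝ, F) ι p (Y p))) :
    metricForm g (ι p) (inducedMetric g ι p (X p) (Y p) • antiLeeField g J lee (ι p)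
        + secondFundamentalForm g ι p (X p) y + secondFundamentalForm g ι p (Y p) x)
        (J (ι p) (mfderiv 𝓘(ℝ, E) 𝓘(ℝ, F) ι p (ξ p))) =
      -(koszul (inducedMetric g ι) X ξ Y p + koszul (inducedMetric g ι) Y ξ X p) := by
  obtain ⟨U, hU, hp, f, hf, hKU⟩ := hK (ι p)
  have hfd : MDiffAt f (ι p) := (hf.contMDiffAt (hU.mem_nhds hp)).mdifferentiableAt (by simp)
  have hs := (isMetricAt_metricForm g (ι p)).symm (ι p)
  have hsM : ∀ u v : TangentSpace 𝓘(ℝ, E) p, inducedMetric g ι p u v = inducedMetric g ι p v u :=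
    fun u v => hs _ _
  have h1 := apply_secondFundamentalForm_of_eq hH hKU hp hfd hι hι' hX hξ hY hn hXξ hy
  have h2 := apply_secondFundamentalForm_of_eq hH hKU hp hfd hι hι' hY hξ hX hn hYξ hx
  -- The remaining terms are skew, by skew-symmetry of the Kähler form.
  have h3 : inducedMetric g ι p (X p) y = -inducedMetric g ι p (Y p) x := by
    rw [inducedMetric_apply, inducedMetric_apply, hx, hy, hH.apply_right, hs]
  have h4 : lee (ι p) (mfderiv 𝓘(ℝ, E) 𝓘(ℝ, F) ι p (ξ p)) * inducedMetric g ι p (X p) (Y p) =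
      mvfderiv 𝓘(ℝ, F) f (ι p) (mfderiv 𝓘(ℝ, E) 𝓘(ℝ, F) ι p (ξ p)) *
        inducedMetric g ι p (X p) (Y p) := by
    refine hL.apply_mul_eq hH hKU hp hfd ((hs _ _).trans hXξ) ?_ _
    have h5 : metricForm g (ι p) (mfderiv 𝓘(ℝ, E) 𝓘(ℝ, F) ι p (ξ p))
        (J (ι p) (mfderiv 𝓘(ℝ, E) 𝓘(ℝ, F) ι p (X p))) = 0 := by
      rw [hH.apply_right, hs, hn.self_of_nhds, neg_zero]
    exact h5
  rw [LinearMap.BilinForm.add_left, LinearMap.BilinForm.add_left, LinearMap.BilinForm.smul_left,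
    apply_antiLeeField hH, h1, h2, h3, hsM (Y p) (X p)]
  linarith

end SecondFundamentalForm

/-! ### Bundle-like metrics and CR-submanifolds -/

section BundleLike

variable {E : Type*} [NormedAddCommGroup E] [NormedSpace ℝ E] [FiniteDimensional ℝ E]
  {M : Type*} [TopologicalSpace M] [ChartedSpace E M] [IsManifold 𝓘(ℝ, E) ∞ M]

theorem orthDistribution_orthDistribution {g : BilinField E M} (hg : ∀ p, IsMetricAt g p)
    (D : SubspaceField E M) : orthDistribution g (orthDistribution g D) = D := by
  funext p
  have : FiniteDimensional ℝ (TangentSpace 𝓘(ℝ, E) p) := inferInstanceAs (FiniteDimensional ℝ E)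
  exact orthogonal_orthogonal_of_pos ((hg p).symm p) (hg p).pos (D p)

/-- The defect of the induced metric on `D` from being parallel, for the intrinsic connection of the
foliation `D^⊥`, is the symmetric part of the second fundamental form of `D` in the direction
`ξ ∈ D^⊥`. -/
theorem apply_intrinsicConnection_add {g : BilinField E M} (hg : ∀ p, IsMetricAt g p)
    {D : SubspaceField E M} (hD : IsSmoothDistribution D) {X Y Z ξ : VField E M} {p : M}
    (hX : MDiffAt (T% X) p) (hY : MDiffAt (T% Y) p) (hZ : MDiffAt (T% Z) p)
    (hYD : Y p ∈ D p) (hZD : Z p ∈ D p)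
    (hξ : ∀ q, ξ q = X q - orthProj (g q) (D q) (X q)) :
    g p (intrinsicConnection g (orthDistribution g D) X Y p) (Z p)
        + g p (Y p) (intrinsicConnection g (orthDistribution g D) X Z p) =
      mvfderiv 𝓘(ℝ, E) (fun q => g q (Y q) (Z q)) p (X p)
        - (koszul g Y ξ Z p + koszul g Z ξ Y p) := by
  have hfin : ∀ q : M, FiniteDimensional ℝ (TangentSpace 𝓘(ℝ, E) q) :=
    fun q => inferInstanceAs (FiniteDimensional ℝ E)
  have hs := (hg p).symm
  have e : (fun q => orthProj (g q) (orthDistribution g D q) (X q)) = ξ := funext fun q =>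
    (orthProj_orthogonal ((hg q).symm q) (hg q).pos (D q) (X q)).trans (hξ q).symm
  have hW := mdifferentiableAt_orthProj hg hD hX
  have key : ∀ {Y Z : VField E M}, MDiffAt (T% Y) p → MDiffAt (T% Z) p → Z p ∈ D p →
      g p (intrinsicConnection g (orthDistribution g D) X Y p) (Z p) =
        koszul g (fun q => orthProj (g q) (D q) (X q)) Y Z p + koszul g ξ Y Z p
          - koszul g Y ξ Z p := by
    intro Y Z hY hZ hZD
    rw [intrinsicConnection, orthDistribution_orthDistribution hg, e, LinearMap.BilinForm.add_left,
      apply_orthProj_left (hs p) (hg p).pos hZD, apply_orthProj_left (hs p) (hg p).pos hZD,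
      (hg p).apply_leviCivita hW hY hZ, ← koszul_sub_koszul_swap hs]
    ring
  rw [hs p (Y p), key hY hZ hZD, key hZ hY hYD]
  have h1 := koszul_add_koszul_swap (p := p) hs (fun q => orthProj (g q) (D q) (X q)) Y Z
  have h2 := koszul_add_koszul_swap (p := p) hs ξ Y Z
  have h3 : mvfderiv 𝓘(ℝ, E) (fun q => g q (Y q) (Z q)) p (X p) =
      mvfderiv 𝓘(ℝ, E) (fun q => g q (Y q) (Z q)) p (orthProj (g p) (D p) (X p))
        + mvfderiv 𝓘(ℝ, E) (fun q => g q (Y q) (Z q)) p (ξ p) := by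
    rw [← map_add, hξ, add_sub_cancel]
  linarith

end BundleLike

section CR

variable {F : Type*} [NormedAddCommGroup F] [NormedSpace ℝ F]
  {N : Type*} [TopologicalSpace N] [ChartedSpace F N] [IsManifold 𝓘(ℝ, F) ∞ N]
  {E : Type*} [NormedAddCommGroup E] [NormedSpace ℝ E]
  {M : Type*} [TopologicalSpace M] [ChartedSpace E M] [IsManifold 𝓘(ℝ, E) ∞ M]
  {g : SmoothMetric F N} {J : EndField F N} {ι : M → N} {D : SubspaceField E M}

theorem IsCRSubmanifold.apply_eq_zero (hCR : IsCRSubmanifold g J ι D) {p : M}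
    {x : TangentSpace 𝓘(ℝ, E) p} (hx : x ∈ orthDistribution (inducedMetric g ι) D p)
    (w : TangentSpace 𝓘(ℝ, E) p) :
    metricForm g (ι p) (mfderiv 𝓘(ℝ, E) 𝓘(ℝ, F) ι p w)
      (J (ι p) (mfderiv 𝓘(ℝ, E) 𝓘(ℝ, F) ι p x)) = 0 :=
  hCR.totallyReal p (Submodule.mem_map_of_mem (Submodule.mem_map_of_mem hx)) _ ⟨w, rfl⟩

variable [FiniteDimensional ℝ F]

theorem IsCRSubmanifold.mem_tangentImage_sup_muBundle (hCR : IsCRSubmanifold g J ι D) {p : M}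
    {w : TangentSpace 𝓘(ℝ, F) (ι p)} :
    w ∈ tangentImage E ι p ⊔ muBundle g J ι D p ↔
      ∀ x ∈ orthDistribution (inducedMetric g ι) D p,
        metricForm g (ι p) w (J (ι p) (mfderiv 𝓘(ℝ, E) 𝓘(ℝ, F) ι p x)) = 0 := by
  have hg := isMetricAt_metricForm g (ι p)
  have : FiniteDimensional ℝ (TangentSpace 𝓘(ℝ, F) (ι p)) :=
    inferInstanceAs (FiniteDimensional ℝ F)
  rw [muBundle, sup_orthogonal_inf_orthogonal (hg.symm _) hg.pos (hCR.totallyReal p)]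
  constructor
  · intro h x hx
    rw [hg.symm]
    exact h _ (Submodule.mem_map_of_mem (Submodule.mem_map_of_mem hx))
  · rintro h _ ⟨_, ⟨x, hx, rfl⟩, rfl⟩
    exact (hg.symm _ _ _).trans (h x hx)

end CR

end CRGeometry

end

theorem mainTheorem3
    {F : Type*} [NormedAddCommGroup F] [NormedSpace ℝ F] [FiniteDimensional ℝ F]
    {N : Type*} [TopologicalSpace N] [T2Space N] [ChartedSpace F N] [IsManifold 𝓘(ℝ, F) ∞ N]
    (gbar : SmoothMetric F N) (J : EndField F N)
    (hH : IsAlmostHermitian gbar J) (hK : IsLCK gbar J)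
    (lee : CovectorField F N) (hL : IsLeeForm gbar J lee)
    {E : Type*} [NormedAddCommGroup E] [NormedSpace ℝ E] [FiniteDimensional ℝ E]
    {M : Type*} [TopologicalSpace M] [T2Space M] [ChartedSpace E M] [IsManifold 𝓘(ℝ, E) ∞ M]
    (ι : M → N) (hι : ContMDiff 𝓘(ℝ, E) 𝓘(ℝ, F) ∞ ι)
    (hι' : ∀ p, Function.Injective (mfderiv 𝓘(ℝ, E) 𝓘(ℝ, F) ι p))
    (D : SubspaceField E M) (hCR : IsCRSubmanifold gbar J ι D) :
    IsBundleLike (inducedMetric gbar ι) (orthDistribution (inducedMetric gbar ι) D) ↔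
      ∀ (p : M), ∀ u ∈ D p, ∀ v ∈ D p, ∀ ju jv : TangentSpace 𝓘(ℝ, E) p,
        mfderiv 𝓘(ℝ, E) 𝓘(ℝ, F) ι p ju = J (ι p) (mfderiv 𝓘(ℝ, E) 𝓘(ℝ, F) ι p u) →
        mfderiv 𝓘(ℝ, E) 𝓘(ℝ, F) ι p jv = J (ι p) (mfderiv 𝓘(ℝ, E) 𝓘(ℝ, F) ι p v) →
        inducedMetric gbar ι p u v • antiLeeField gbar J lee (ι p)
            + secondFundamentalForm gbar ι p u jv + secondFundamentalForm gbar ι p v ju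
          ∈ tangentImage E ι p ⊔ muBundle gbar J ι D p := by
  have hg : ∀ p, IsMetricAt (inducedMetric gbar ι) p :=
    fun p => isMetricAt_inducedMetric gbar hι p (hι' p)
  have hd : ∀ {X : VField E M}, IsSmoothField X → ∀ p, MDiffAt (T% X) p :=
    fun hX p => (hX p).mdifferentiableAt (by simp)
  have hfin : ∀ q : M, FiniteDimensional ℝ (TangentSpace 𝓘(ℝ, E) q) :=
    fun q => inferInstanceAs (FiniteDimensional ℝ E)
  -- The component of a vector field tangent to the foliation.
  have hξ : ∀ {X : VField E M}, IsSmoothField X →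
      (∀ q, X q - orthProj (inducedMetric gbar ι q) (D q) (X q) ∈
        orthDistribution (inducedMetric gbar ι) D q) ∧
      ∀ q, MDiffAt (T% (fun q => X q - orthProj (inducedMetric gbar ι q) (D q) (X q))) q :=
    fun {X} hX => ⟨fun q => sub_orthProj_mem ((hg q).symm q) (hg q).pos (D q) (X q),
      fun q => mdifferentiableAt_sub_section (hd hX q)
        (mdifferentiableAt_orthProj hg hCR.smooth (hd hX q))⟩
  constructor
  · intro hB p u hu v hv ju jv hju hjv
    rw [hCR.mem_tangentImage_sup_muBundle]
    intro x hx
    obtain ⟨U, hU, hUD, rfl⟩ := hCR.smooth.exists_isSmoothField hu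
    obtain ⟨V, hV, hVD, rfl⟩ := hCR.smooth.exists_isSmoothField hv
    obtain ⟨X, hX, rfl⟩ := exists_isSmoothField x
    obtain ⟨hξ1, hξ2⟩ := hξ hX
    have hx0 : orthProj (inducedMetric gbar ι p) (D p) (X p) = 0 :=
      orthProj_eq_of_mem ((hg p).symm p) (hg p).pos (Submodule.zero_mem _) (by rwa [sub_zero])
    have h1 := apply_smul_antiLeeField_add_secondFundamentalForm hH hK hL hι (hι' p) (hd hU p)
      (hξ2 p) (hd hV p) (Filter.Eventually.of_forall fun q => hCR.apply_eq_zero (hξ1 q))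
      (hξ1 p _ hu) (hξ1 p _ hv) hju hjv
    have h2 := apply_intrinsicConnection_add hg hCR.smooth (hd hX p) (hd hU p) (hd hV p) hu hv
      (fun q => rfl)
    have h3 := hB X U V hX hU hV (by rwa [orthDistribution_orthDistribution hg])
      (by rwa [orthDistribution_orthDistribution hg]) p
    rw [hx0, sub_zero] at h1
    rw [h1]
    linarith
  · intro h X Y Z hX hY hZ hYD hZD p
    rw [orthDistribution_orthDistribution hg] at hYD hZD
    obtain ⟨hξ1, hξ2⟩ := hξ hX
    have hJ : ∀ {y}, y ∈ D p → ∃ jy : TangentSpace 𝓘(ℝ, E) p,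
        mfderiv 𝓘(ℝ, E) 𝓘(ℝ, F) ι p jy = J (ι p) (mfderiv 𝓘(ℝ, E) 𝓘(ℝ, F) ι p y) := by
      intro y hy
      have h0 : J (ι p) (mfderiv 𝓘(ℝ, E) 𝓘(ℝ, F) ι p y) ∈ mapJ J ι D p :=
        Submodule.mem_map_of_mem (Submodule.mem_map_of_mem hy)
      rw [hCR.holomorphic] at h0
      obtain ⟨w, -, hw⟩ := h0
      exact ⟨w, hw⟩
    obtain ⟨jy, hjy⟩ := hJ (hYD p)
    obtain ⟨jz, hjz⟩ := hJ (hZD p)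
    have h1 := apply_smul_antiLeeField_add_secondFundamentalForm hH hK hL hι (hι' p) (hd hY p)
      (hξ2 p) (hd hZ p) (Filter.Eventually.of_forall fun q => hCR.apply_eq_zero (hξ1 q))
      (hξ1 p _ (hYD p)) (hξ1 p _ (hZD p)) hjy hjz
    have h2 := apply_intrinsicConnection_add hg hCR.smooth (hd hX p) (hd hY p) (hd hZ p) (hYD p)
      (hZD p) (fun q => rfl)
    have h3 := hCR.mem_tangentImage_sup_muBundle.1
      (h p _ (hYD p) _ (hZD p) jy jz hjy hjz) _ (hξ1 p)
    rw [h1] at h3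
    linarith
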